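/- **Theorem 4.9 (Chance Performance).** *System.* Consider the model $E(x)+H(p)x+L(p)z+F(p)f=0$ with $n_r$ equations, where $E:\mathbb R^{n_x}\to\mathbb R^{n_r}$ is Lipschitz continuous, $p$ is the differentiation operator, $H(p)=\sum_{i=0}^{d_H}H_ip^i$, $L(p)=\sum_{i=0}^{d_L}L_ip^i$ and $F(p)=\sum_{i=0}^{d_F}F_ip^i$ with constant real matrices $H_i,L_i,F_i$ having $n_x$, $n_z$, $n_f$ columns. Let $T>0$, let $d_N\in\mathbb N$, and let $a(p)$ be a real polynomial of degree at least $d_N$ all of whose complex roots have negative real part. A row polynomial $N(p)=\sum_{i=0}^{d_N}N_ip^i$ with $n_r$ entries is identified with $\bar N=[N_0\ N_1\ \cdots\ N_{d_N}]\in\mathbb R^{n_r(d_N+1)}$. Let $\bar H,\bar F$ be the block Toeplitz matrices with $d_N+1$ block rows and $d_N+d_H+1$, resp. $d_N+d_F+1$, block columns whose block $(i,j)$ is $H_{j-i}$, resp. $F_{j-i}$ (zero if the index is out of range); so $\bar N\bar H$ and $\bar N\bar F$ list the coefficients of $N(p)H(p)$ and $N(p)F(p)$. *Signals.* Let $\mathcal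 W_T^{k}$ be the space of piecewise continuous functions $[0,T]\to\mathbb R^{k}$ with the $L^2$-topology and its Borel $\sigma$-algebra. For $x\in\mathcal W^{n_x}_T$ let $e_x(t)=E(x(t))$ and let $r_x[\bar N]=-a^{-1}(p)N(p)[e_x]$ be the negative of the output on $[0,T]$ of the linear filter with transfer function $N(p)/a(p)$, started at rest, under the input $e_x$. Write $r_x[\bar N](t)=\bar N\psi_x(t)$, where $\psi_x$ stacks the signals $-a^{-1}(p)p^i[e_x]$, $0\le i\le d_N$, and put $Q_x=\int_0^T\psi_x(t)\psi_x(t)^{\top}dt$, so that $\|r_x[\bar N]\|_{L^2}^2=\bar NQ_x\bar N^{\top}$. *Program.* Let $(\Omega,\mathfrak S,\mathbb P)$ be a probability space, $x:\Omega\to\mathcal W_T^{n_x}$ measurable, $n\in\mathbb N$, and let $x_1,\dots,x_n$ be the $n$ independent copies $x_i(\omega)=x(\omega_i)$ of $x$ on $(\Omega^n,\mathfrak S^n,\mathbb P^n)$. The two-stage scenario program is $$(1)\ \ \min_{\gamma,\bar N}\ \gamma\quad\text{s.t. } \bar N\bar H=0,\ \|\bar N\bar F\|_\infty\ge1,\ \max_{i\le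 n}\bar NQ_{x_i}\bar N^{\top}\le\gamma,$$ $$(2)\ \ \max_{\bar N}\ \|\bar N\bar F\|_\infty\quad\text{s.t. } \bar N\bar H=0,\ \|\bar N\|_\infty\le1,\ \|\bar N_1^*\|_\infty^2\max_{i\le n}\bar NQ_{x_i}\bar N^{\top}\le\gamma_1^*,$$ where $(\bar N_1^*,\gamma_1^*)$ is a solution of (1). If $\bar N_2^*$ is a solution of (2), then $(\bar N_2^*,\ \gamma_1^*/\|\bar N_1^*\|_\infty^2)$, and more generally every joint rescaling $(c\bar N_2^*,\ c^2\gamma_1^*/\|\bar N_1^*\|_\infty^2)$ with $c>0$ (for instance $(\|\bar N_1^*\|_\infty\bar N_2^*,\ \gamma_1^*)$), is called a solution of the two-stage program. *Claim.* Let $\varepsilon\in(0,1)$, and let $\bar N_n^*:\Omega^n\to\mathbb R^{n_r(d_N+1)}$ and $\gamma_n^*:\Omega^n\to\mathbb R$ be $\mathfrak S^n$-measurable such that $(\bar N_n^*,\gamma_n^*)$ is, $\mathbb P^n$-almost surely, a solution of the two-stage program. Then the event $$\mathcal E=\Big\{\mathbb P\big(\|r_x[\bar N_n^*]\|_{L^2}^2>\gamma_n^*\big)>\varepsilon\Big\}\subseteq\Omega^n$$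 (the inner probability is over a new signal $x$, independent of the samples) is $\mathfrak S^n$-measurable. Suppose moreover that $\mathbb P^n$-almost surely the optimal filter of (1) is unique in each convex piece of its feasible set, that is, for each of the $n_f(d_F+d_N+1)$ coordinates $j$ there is at most one $\bar N$ with $(\bar N\bar F)_j\ge1$ that is part of a solution of (1). Then for every $\beta\in(0,1)$, $$n\ \ge\ \frac2\varepsilon\Big(\ln\frac{n_f(d_F+d_N+1)}{\beta}+n_r(d_N+1)+1\Big)\quad\Longrightarrow\quad \mathbb P^n(\mathcal E)<\beta .$$ -/

import Mathlib

open MeasureTheory Set Filter Topology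

namespace FDI

/-! ### Signals -/

/-- Piecewise continuous signals on the horizon `[0, T]` with values in `ℝⁿ`: finitely many
discontinuities, and one-sided limits everywhere. A signal is carried by a function on `ℝ`, of
which only the values on `[0, T]` are ever used. -/
structure PWC (T : ℝ) (n : ℕ) where
  toFun : ℝ → EuclideanSpace ℝ (Fin n)
  finite_disc : ∃ S : Finset ℝ, ∀ t ∈ Icc (0 : ℝ) T, t ∉ S →
    ContinuousWithinAt toFun (Icc (0 : ℝ) T) t
  right_lim : ∀ t ∈ Ico (0 : ℝ) T, ∃ l, Tendsto toFun (𝓝[>] t) (𝓝 l)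
  left_lim : ∀ t ∈ Ioc (0 : ℝ) T, ∃ l, Tendsto toFun (𝓝[<] t) (𝓝 l)

namespace PWC

variable {T : ℝ} {n : ℕ}

theorem exists_bound (x : PWC T n) : ∃ C : ℝ, ∀ t ∈ Icc (0 : ℝ) T, ‖x.toFun t‖ ≤ C := by
  have key : ∃ C : ℝ, ∀ t ∈ Icc (0 : ℝ) T, ‖x.toFun t‖ < C := by
    refine isCompact_Icc.induction_on
      (p := fun s => ∃ C : ℝ, ∀ t ∈ s, ‖x.toFun t‖ < C) ⟨0, by simp⟩
      (fun s t hst ⟨C, hC⟩ => ⟨C, fun u hu => hC u (hst hu)⟩) ?_ ?_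
    · rintro s t ⟨C, hC⟩ ⟨D, hD⟩
      refine ⟨max C D, ?_⟩
      rintro u (hu | hu)
      · exact lt_max_of_lt_left (hC u hu)
      · exact lt_max_of_lt_right (hD u hu)
    · intro t ht
      have bdd : ∀ {f : Filter ℝ} {l}, Tendsto x.toFun f (𝓝 l) →
          ∀ᶠ u in f, ‖x.toFun u‖ < ‖l‖ + 1 := fun h =>
        h.norm.eventually (gt_mem_nhds (lt_add_one _))
      have hR : ∃ C : ℝ, ∀ᶠ u in 𝓝[Icc (0 : ℝ) T ∩ Ioi t] t, ‖x.toFun u‖ < C := by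
        rcases lt_or_eq_of_le ht.2 with h | h
        · obtain ⟨l, hl⟩ := x.right_lim t ⟨ht.1, h⟩
          exact ⟨_, (bdd hl).filter_mono (nhdsWithin_mono t inter_subset_right)⟩
        · refine ⟨0, ?_⟩
          have : Icc (0 : ℝ) T ∩ Ioi t = ∅ := by
            ext u; simp only [mem_inter_iff, mem_Icc, mem_Ioi, mem_empty_iff_false, iff_false]
            rintro ⟨⟨_, h1⟩, h2⟩; linarith
          simp [this]
      have hL : ∃ C : ℝ, ∀ᶠ u in 𝓝[Icc (0 : ℝ) T ∩ Iio t] t, ‖x.toFun u‖ < C := by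
        rcases lt_or_eq_of_le ht.1 with h | h
        · obtain ⟨l, hl⟩ := x.left_lim t ⟨h, ht.2⟩
          exact ⟨_, (bdd hl).filter_mono (nhdsWithin_mono t inter_subset_right)⟩
        · refine ⟨0, ?_⟩
          have : Icc (0 : ℝ) T ∩ Iio t = ∅ := by
            ext u; simp only [mem_inter_iff, mem_Icc, mem_Iio, mem_empty_iff_false, iff_false]
            rintro ⟨⟨h1, _⟩, h2⟩; linarith
          simp [this]
      obtain ⟨C, hC⟩ := hR
      obtain ⟨D, hD⟩ := hL
      rw [eventually_nhdsWithin_iff] at hC hD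
      refine ⟨{u | ‖x.toFun u‖ < max (max C D) (‖x.toFun t‖ + 1)}, ?_, _, fun u hu => hu⟩
      change ∀ᶠ u in 𝓝[Icc (0 : ℝ) T] t, _
      rw [eventually_nhdsWithin_iff]
      filter_upwards [hC, hD] with u h1 h2 hu
      rcases lt_trichotomy u t with h | h | h
      · exact lt_max_of_lt_left (lt_max_of_lt_right (h2 ⟨hu, h⟩))
      · subst h; exact lt_max_of_lt_right (lt_add_one _)
      · exact lt_max_of_lt_left (lt_max_of_lt_left (h1 ⟨hu, h⟩))
  exact key.imp fun C hC t ht => (hC t ht).le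

theorem memLp (x : PWC T n) : MemLp x.toFun 2 (volume.restrict (Icc (0 : ℝ) T)) := by
  obtain ⟨S, hS⟩ := x.finite_disc
  obtain ⟨C, hC⟩ := x.exists_bound
  have hcont : ContinuousOn x.toFun (Icc (0 : ℝ) T \ S) := fun t ht =>
    (hS t ht.1 (by simpa using ht.2)).mono sdiff_subset
  have hae : (Icc (0 : ℝ) T \ S : Set ℝ) =ᵐ[volume] Icc (0 : ℝ) T :=
    sdiff_null_ae_eq_self (S.finite_toSet.measure_zero _)
  have hm : AEStronglyMeasurable x.toFun (volume.restrict (Icc (0 : ℝ) T)) := by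
    rw [← Measure.restrict_congr_set hae]
    exact hcont.aestronglyMeasurable (measurableSet_Icc.diff S.measurableSet)
  exact MemLp.of_bound hm C ((ae_restrict_iff' measurableSet_Icc).2 (ae_of_all _ hC))

/-- The class of a signal in `L²([0, T]; ℝⁿ)`. -/
noncomputable def toL2 (x : PWC T n) :
    Lp (EuclideanSpace ℝ (Fin n)) 2 (volume.restrict (Icc (0 : ℝ) T)) :=
  x.memLp.toLp x.toFun

/-- The `L²`-topology on the space of piecewise continuous signals. -/
noncomputable instance : TopologicalSpace (PWC T n) :=
  TopologicalSpace.induced toL2 inferInstance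

/-- The Borel sigma-algebra of the `L²`-topology. -/
noncomputable instance : MeasurableSpace (PWC T n) := borel _

instance : BorelSpace (PWC T n) := ⟨rfl⟩

end PWC

/-- The `L²`-norm of a scalar signal on `[0, T]`. -/
noncomputable def l2Norm (T : ℝ) (r : ℝ → ℝ) : ℝ := √(∫ t in (0 : ℝ)..T, r t ^ 2)

/-! ### The system -/

/-- The data of the differential-algebraic model `E(x) + H(p) x + L(p) z + F(p) f = 0` with
`nr` equations, where `H(p) = ∑ Hᵢ pⁱ`, `L(p) = ∑ Lᵢ pⁱ`, `F(p) = ∑ Fᵢ pⁱ`. -/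
structure DAE (nr nx nz nf dH dL dF : ℕ) where
  E : EuclideanSpace ℝ (Fin nx) → EuclideanSpace ℝ (Fin nr)
  lipschitz : ∃ K, LipschitzWith K E
  H : Fin (dH + 1) → Matrix (Fin nr) (Fin nx) ℝ
  L : Fin (dL + 1) → Matrix (Fin nr) (Fin nz) ℝ
  F : Fin (dF + 1) → Matrix (Fin nr) (Fin nf) ℝ

/-- The row vector `[N₀ N₁ ⋯ N_{dN}]` of the coefficients of a row polynomial
`N(p) = ∑ Nᵢ pⁱ` with `nr` entries. Its norm `‖·‖` is the maximum norm. -/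
abbrev Coeffs (dN nr : ℕ) : Type := Fin (dN + 1) × Fin nr → ℝ

/-- The block Toeplitz matrix of `M(p) = ∑_{i ≤ d} Mᵢ pⁱ`: row block `i`, column block `j` is
`M_{j-i}` if `0 ≤ j - i ≤ d` and zero otherwise. -/
def blockToeplitz (dN : ℕ) {d r c : ℕ} (M : Fin (d + 1) → Matrix (Fin r) (Fin c) ℝ) :
    Matrix (Fin (dN + 1) × Fin r) (Fin (dN + d + 1) × Fin c) ℝ :=
  Matrix.of fun i j =>
    if h : i.1.1 ≤ j.1.1 ∧ j.1.1 - i.1.1 < d + 1 then M ⟨j.1.1 - i.1.1, h.2⟩ i.2 j.2 else 0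

/-! ### The linear filter `a⁻¹(p) N(p)` -/

/-- A real polynomial is stable if all its complex roots have negative real part. (The zero
polynomial is not stable.) -/
def IsStable (a : Polynomial ℝ) : Prop :=
  ∀ z : ℂ, Polynomial.aeval z a = 0 → z.re < 0

/-- State matrix of the equation `a(p) v = u` in the state `(v, p v, …, p^{ℓ-1} v)`, with
`ℓ` the degree of `a`. -/
noncomputable def stateMatrix (a : Polynomial ℝ) :
    Matrix (Fin a.natDegree) (Fin a.natDegree) ℝ :=
  Matrix.of fun i j =>
    if i.1 + 1 = a.natDegree then -(a.coeff j / a.leadingCoeff)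
    else if i.1 + 1 = j.1 then 1 else 0

/-- Input vector of the equation `a(p) v = u` in the state `(v, p v, …, p^{ℓ-1} v)`. -/
noncomputable def inputVector (a : Polynomial ℝ) : Fin a.natDegree → ℝ :=
  fun i => if i.1 + 1 = a.natDegree then a.leadingCoeff⁻¹ else 0

/-- The state `(v, p v, …, p^{ℓ-1} v)` at time `t`, started from zero, under the input `u`. -/
noncomputable def filterState (a : Polynomial ℝ) (u : ℝ → ℝ) (t : ℝ) : Fin a.natDegree → ℝ :=
  fun j => ∫ τ in (0 : ℝ)..t,
    (NormedSpace.exp ((t - τ) • stateMatrix a)).mulVec (inputVector a) j * u τ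

/-- The response `a⁻¹(p) pⁱ [u] (t)`, for `i` at most the degree `ℓ` of `a`: the state component
`pⁱ v` if `i < ℓ`, and `p^ℓ v = (u - ∑_{j < ℓ} a_j p^j v) / a_ℓ` if `i = ℓ`. -/
noncomputable def response (a : Polynomial ℝ) (i : ℕ) (u : ℝ → ℝ) (t : ℝ) : ℝ :=
  if h : i < a.natDegree then filterState a u t ⟨i, h⟩
  else (u t - ∑ j : Fin a.natDegree, a.coeff j * filterState a u t j) / a.leadingCoeff

section Residual

variable {nr nx nz nf dH dL dF dN : ℕ} {T : ℝ}

/-- The nonlinearity signature `e_x(t) = E(x(t))`. -/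
def signature (S : DAE nr nx nz nf dH dL dF) (x : PWC T nx) (t : ℝ) :
    EuclideanSpace ℝ (Fin nr) := S.E (x.toFun t)

/-- The contribution `r_x[N] = -a⁻¹(p) N(p) [e_x]` of the nonlinearity to the residual. -/
noncomputable def residual (S : DAE nr nx nz nf dH dL dF) (a : Polynomial ℝ)
    (N : Coeffs dN nr) (x : PWC T nx) (t : ℝ) : ℝ :=
  -∑ i : Fin (dN + 1), ∑ l : Fin nr, N (i, l) * response a i (fun τ => signature S x τ l) t

/-- The signal `ψ_x` with `r_x[N] = N ψ_x` for every coefficient vector `N`. -/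
noncomputable def psi (S : DAE nr nx nz nf dH dL dF) (a : Polynomial ℝ) (dN : ℕ)
    (x : PWC T nx) (t : ℝ) : Coeffs dN nr :=
  fun i => -response a i.1 (fun τ => signature S x τ i.2) t

/-- The signature matrix `Q_x = ∫₀ᵀ ψ_x(t) ψ_x(t)ᵀ dt`. -/
noncomputable def signatureMatrix (S : DAE nr nx nz nf dH dL dF) (a : Polynomial ℝ) (dN : ℕ)
    (x : PWC T nx) : Matrix (Fin (dN + 1) × Fin nr) (Fin (dN + 1) × Fin nr) ℝ :=
  Matrix.of fun i j => ∫ t in (0 : ℝ)..T, psi S a dN x t i * psi S a dN x t j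

end Residual

/-! ### The two-stage scenario program -/

section Program

variable {nr nx nz nf dH dL dF dN n : ℕ}

/-- The quadratic form `N Q Nᵀ`. -/
def quadForm (Q : Matrix (Fin (dN + 1) × Fin nr) (Fin (dN + 1) × Fin nr) ℝ)
    (N : Coeffs dN nr) : ℝ := N ⬝ᵥ Q.mulVec N

/-- Feasibility for the first stage: `N H̄ = 0`, `‖N F̄‖_∞ ≥ 1`, `maxᵢ N Qᵢ Nᵀ ≤ γ`. -/
def StageOneFeasible (S : DAE nr nx nz nf dH dL dF)
    (Q : Fin n → Matrix (Fin (dN + 1) × Fin nr) (Fin (dN + 1) × Fin nr) ℝ)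
    (N : Coeffs dN nr) (γ : ℝ) : Prop :=
  Matrix.vecMul N (blockToeplitz dN S.H) = 0 ∧
  1 ≤ ‖Matrix.vecMul N (blockToeplitz dN S.F)‖ ∧
  ∀ i, quadForm (Q i) N ≤ γ

/-- Solutions of the first stage: minimize `γ` over the feasible `(N, γ)`. -/
def IsStageOneSolution (S : DAE nr nx nz nf dH dL dF)
    (Q : Fin n → Matrix (Fin (dN + 1) × Fin nr) (Fin (dN + 1) × Fin nr) ℝ)
    (N : Coeffs dN nr) (γ : ℝ) : Prop :=
  StageOneFeasible S Q N γ ∧ ∀ N' γ', StageOneFeasible S Q N' γ' → γ ≤ γ'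

/-- Feasibility for the second stage, given the first-stage solution `(N₁, γ₁)`:
`N H̄ = 0`, `‖N‖_∞ ≤ 1`, `‖N₁‖_∞² maxᵢ N Qᵢ Nᵀ ≤ γ₁`. -/
def StageTwoFeasible (S : DAE nr nx nz nf dH dL dF)
    (Q : Fin n → Matrix (Fin (dN + 1) × Fin nr) (Fin (dN + 1) × Fin nr) ℝ)
    (N₁ : Coeffs dN nr) (γ₁ : ℝ) (N : Coeffs dN nr) : Prop :=
  Matrix.vecMul N (blockToeplitz dN S.H) = 0 ∧
  ‖N‖ ≤ 1 ∧
  ∀ i, ‖N₁‖ ^ 2 * quadForm (Q i) N ≤ γ₁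

/-- Solutions of the second stage: maximize `‖N F̄‖_∞` over the feasible `N`. -/
def IsStageTwoSolution (S : DAE nr nx nz nf dH dL dF)
    (Q : Fin n → Matrix (Fin (dN + 1) × Fin nr) (Fin (dN + 1) × Fin nr) ℝ)
    (N₁ : Coeffs dN nr) (γ₁ : ℝ) (N : Coeffs dN nr) : Prop :=
  StageTwoFeasible S Q N₁ γ₁ N ∧ ∀ N', StageTwoFeasible S Q N₁ γ₁ N' →
    ‖Matrix.vecMul N' (blockToeplitz dN S.F)‖ ≤ ‖Matrix.vecMul N (blockToeplitz dN S.F)‖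

/-- `(N, γ)` is a filter and threshold obtained from the two-stage program: for a first-stage
solution `(N₁, γ₁)` and a subsequent second-stage solution `N₂`, the pair is
`(N₂, γ₁ / ‖N₁‖_∞²)` up to the joint normalization `(c N₂, c² γ₁ / ‖N₁‖_∞²)`, `c > 0`. The choice
`c = 1` gives the second-stage filter itself, the choice `c = ‖N₁‖_∞` gives the first-stage
threshold `γ = γ₁`. -/
def IsTwoStageSolution (S : DAE nr nx nz nf dH dL dF)
    (Q : Fin n → Matrix (Fin (dN + 1) × Fin nr) (Fin (dN + 1) × Fin nr) ℝ)
    (N : Coeffs dN nr) (γ : ℝ) : Prop :=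
  ∃ (N₁ : Coeffs dN nr) (γ₁ : ℝ) (N₂ : Coeffs dN nr) (c : ℝ),
    IsStageOneSolution S Q N₁ γ₁ ∧ IsStageTwoSolution S Q N₁ γ₁ N₂ ∧
    0 < c ∧ N = c • N₂ ∧ γ = c ^ 2 * (γ₁ / ‖N₁‖ ^ 2)

/-- Uniqueness of the optimal filter in each convex piece `(N F̄)ⱼ ≥ 1` of the nonconvex
constraint. (It holds in particular if the first stage has only one solution up to the
unavoidable change of sign `N ↦ -N`.) -/
def UniqueInPieces (S : DAE nr nx nz nf dH dL dF)
    (Q : Fin n → Matrix (Fin (dN + 1) × Fin nr) (Fin (dN + 1) × Fin nr) ℝ) : Prop :=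
  ∀ (j : Fin (dN + dF + 1) × Fin nf) (N N' : Coeffs dN nr) (γ : ℝ),
    IsStageOneSolution S Q N γ → IsStageOneSolution S Q N' γ →
    1 ≤ Matrix.vecMul N (blockToeplitz dN S.F) j →
    1 ≤ Matrix.vecMul N' (blockToeplitz dN S.F) j → N = N'

end Program

/-- The event, in the space of the `n` samples, that the false-alarm probability
`ℙ(‖r_x[N]‖² > γ)` of the random filter `N` with the random threshold `γ` exceeds `ε`. -/
def falseAlarmEvent {nr nx nz nf dH dL dF dN n : ℕ} {T : ℝ} {Ω : Type*} [MeasurableSpace Ω]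
    (P : Measure Ω) (S : DAE nr nx nz nf dH dL dF) (a : Polynomial ℝ) (x : Ω → PWC T nx)
    (N : (Fin n → Ω) → Coeffs dN nr) (γ : (Fin n → Ω) → ℝ) (ε : ℝ) : Set (Fin n → Ω) :=
  {ω | ε < P.real {ω' | γ ω < l2Norm T (residual S a (N ω) (x ω')) ^ 2}}

end FDI

namespace FDI

/-! A false alarm is a quadratic event: `l2Norm_residual_sq` rewrites it as γ < N Q_x Nᵀ, with a
positive semidefinite Q_x that depends continuously on x. This gives measurability.

The event is unchanged under (N, γ) ↦ (cN, c²γ). Under uniqueness in pieces, every two-stage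
solution is such a rescaling of a first-stage solution (`IsTwoStageSolution.normalize`). Since N and
-N are equally good, some sign of it lies in one of J = nf(dF + dN + 1) convex pieces (N F̄)ⱼ ≥ 1,
and it suffices to bound the part of the event in each piece by β / J.

Inside a piece the program is convex in d = nr(dN + 1) + 1 variables, γ included. Ties are broken by
the Euclidean norm (`IsLexOptimal`), so that subprograms with fewer samples also have at most one
optimum. By Helly's theorem some d samples determine the optimum, and so does every set T of samples
containing them (`IsLexOptimal.exists_basis`). For a fixed T of size t = ⌊n/2⌋, the samples in T fix
the optimum; if its false-alarm probability exceeds ε, the other n - t independent samples all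
respect its threshold with probability at most (1 - ε)^(n - t). Each bad outcome is counted for at
least C(n - d, t - d) sets T, so averaging over T (`measure_mul_choose_le`) bounds the measure by
C(n, n - t)(1 - ε)^(n - t) / C(n - d, n - t). The sample size makes this less than β / J
(`choose_mul_pow_lt`). -/

/-- Lebesgue measure on the horizon `[0, T]`. -/
noncomputable abbrev horizon (T : ℝ) : Measure ℝ := volume.restrict (Icc (0 : ℝ) T)

/-! ### Filter responses on a finite horizon. -/

theorem continuous_impulse (a : Polynomial ℝ) (j : Fin a.natDegree) :
    Continuous fun s : ℝ => (NormedSpace.exp (s • stateMatrix a)).mulVec (inputVector a) j := by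
  have h : Continuous fun s : ℝ => NormedSpace.exp (s • stateMatrix a) := by
    open scoped Matrix.Norms.Operator in
    exact NormedSpace.exp_continuous.comp (continuous_id.smul continuous_const)
  exact (continuous_apply j).comp (h.matrix_mulVec continuous_const)

/-- A bound on the impulse responses of the state over the horizon. -/
theorem exists_impulse_bound (a : Polynomial ℝ) (T : ℝ) :
    ∃ M : ℝ, 0 ≤ M ∧ ∀ s ∈ Icc (0 : ℝ) T, ∀ j,
      |(NormedSpace.exp (s • stateMatrix a)).mulVec (inputVector a) j| ≤ M := by
  have h : ∀ j, ∃ M : ℝ, ∀ s ∈ Icc (0 : ℝ) T,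
      ‖(NormedSpace.exp (s • stateMatrix a)).mulVec (inputVector a) j‖ ≤ M := fun j =>
    isCompact_Icc.exists_bound_of_continuousOn (continuous_impulse a j).continuousOn
  choose M hM using h
  refine ⟨∑ j, |M j|, Finset.sum_nonneg fun _ _ => abs_nonneg _, fun s hs j => ?_⟩
  exact ((hM j s hs).trans (le_abs_self _)).trans
    (Finset.single_le_sum (f := fun j => |M j|) (fun _ _ => abs_nonneg _) (Finset.mem_univ j))

section Signals

variable {T : ℝ} {u v : ℝ → ℝ}

theorem intervalIntegrable_impulse_mul (a : Polynomial ℝ) (j : Fin a.natDegree)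
    (hu : Integrable u (horizon T)) {t : ℝ} (ht : t ∈ Icc (0 : ℝ) T) :
    IntervalIntegrable (fun τ =>
      (NormedSpace.exp ((t - τ) • stateMatrix a)).mulVec (inputVector a) j * u τ) volume 0 t := by
  have h1 : IntervalIntegrable u volume 0 t := by
    rw [intervalIntegrable_iff_integrableOn_Icc_of_le ht.1]
    exact IntegrableOn.mono_set (t := Icc 0 T) hu (Icc_subset_Icc_right ht.2)
  exact h1.continuousOn_mul
    ((continuous_impulse a j).comp (continuous_const.sub continuous_id)).continuousOn

theorem filterState_sub (a : Polynomial ℝ) (hu : Integrable u (horizon T)) (hv : Integrable v (horizon T))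
    {t : ℝ} (ht : t ∈ Icc (0 : ℝ) T) (j : Fin a.natDegree) :
    filterState a (fun τ => u τ - v τ) t j = filterState a u t j - filterState a v t j := by
  simp only [filterState, mul_sub]
  exact intervalIntegral.integral_sub (intervalIntegrable_impulse_mul a j hu ht)
    (intervalIntegrable_impulse_mul a j hv ht)

theorem response_sub (a : Polynomial ℝ) (hu : Integrable u (horizon T)) (hv : Integrable v (horizon T))
    {t : ℝ} (ht : t ∈ Icc (0 : ℝ) T) (i : ℕ) :
    response a i (fun τ => u τ - v τ) t = response a i u t - response a i v t := by
  simp only [response]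
  split_ifs with h
  · exact filterState_sub a hu hv ht _
  · simp only [filterState_sub a hu hv ht, mul_sub, Finset.sum_sub_distrib]
    ring

theorem abs_filterState_le (a : Polynomial ℝ) {M : ℝ} (hM0 : 0 ≤ M)
    (hM : ∀ s ∈ Icc (0 : ℝ) T, ∀ j,
      |(NormedSpace.exp (s • stateMatrix a)).mulVec (inputVector a) j| ≤ M)
    (hu : Integrable u (horizon T)) {t : ℝ} (ht : t ∈ Icc (0 : ℝ) T) (j : Fin a.natDegree) :
    |filterState a u t j| ≤ M * ∫ τ, |u τ| ∂(horizon T) := by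
  have h1 : |filterState a u t j| ≤ ∫ τ in (0 : ℝ)..t, M * |u τ| := by
    rw [← Real.norm_eq_abs]
    refine intervalIntegral.norm_integral_le_of_norm_le ht.1 (ae_of_all _ fun τ hτ => ?_) ?_
    · rw [norm_mul]
      exact mul_le_mul_of_nonneg_right
        (hM _ ⟨by linarith [hτ.2], by linarith [hτ.1, ht.2]⟩ j) (abs_nonneg _)
    · rw [intervalIntegrable_iff_integrableOn_Icc_of_le ht.1]
      exact (IntegrableOn.mono_set (t := Icc 0 T) hu.abs (Icc_subset_Icc_right ht.2)).const_mul M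
  refine h1.trans ?_
  rw [intervalIntegral.integral_const_mul]
  refine mul_le_mul_of_nonneg_left ?_ hM0
  rw [intervalIntegral.integral_of_le ht.1, ← integral_Icc_eq_integral_Ioc]
  exact setIntegral_mono_set hu.abs (ae_of_all _ fun _ => abs_nonneg _)
    (Icc_subset_Icc_right ht.2).eventuallyLE

/-- The response at time `t` is controlled by the input at `t` and its `L¹`-norm. -/
theorem exists_response_bound (a : Polynomial ℝ) (T : ℝ) :
    ∃ A B : ℝ, 0 ≤ A ∧ 0 ≤ B ∧ ∀ (u : ℝ → ℝ), Integrable u (horizon T) →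
      ∀ t ∈ Icc (0 : ℝ) T, ∀ i,
        |response a i u t| ≤ A * |u t| + B * ∫ τ in Icc (0 : ℝ) T, |u τ| := by
  obtain ⟨M, hM0, hM⟩ := exists_impulse_bound a T
  set K := ∑ j : Fin a.natDegree, |a.coeff j|
  have hK : 0 ≤ K := Finset.sum_nonneg fun _ _ => abs_nonneg _
  refine ⟨|a.leadingCoeff⁻¹|, M + |a.leadingCoeff⁻¹| * (K * M), abs_nonneg _, by positivity,
    fun u hu t ht i => ?_⟩
  have hI : 0 ≤ ∫ τ in Icc (0 : ℝ) T, |u τ| := integral_nonneg fun _ => abs_nonneg _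
  have hb := abs_filterState_le a hM0 hM hu ht
  have hl := abs_nonneg (a.leadingCoeff⁻¹)
  rw [response]
  split_ifs with h
  · refine (hb ⟨i, h⟩).trans ?_
    have h1 : 0 ≤ |a.leadingCoeff⁻¹| * |u t| := by positivity
    have h2 : 0 ≤ |a.leadingCoeff⁻¹| * (K * M) * ∫ τ in Icc (0 : ℝ) T, |u τ| := by positivity
    linarith
  · rw [div_eq_mul_inv, abs_mul, mul_comm]
    have h1 : |u t - ∑ j : Fin a.natDegree, a.coeff j * filterState a u t j| ≤
        |u t| + K * (M * ∫ τ in Icc (0 : ℝ) T, |u τ|) := by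
      refine (abs_sub _ _).trans (add_le_add le_rfl ?_)
      refine (Finset.abs_sum_le_sum_abs _ _).trans ?_
      rw [Finset.sum_mul]
      refine Finset.sum_le_sum fun j _ => ?_
      rw [abs_mul]
      exact mul_le_mul_of_nonneg_left (hb j) (abs_nonneg _)
    have h2 := mul_le_mul_of_nonneg_left h1 hl
    have h3 : 0 ≤ M * ∫ τ in Icc (0 : ℝ) T, |u τ| := by positivity
    linarith

/-- Cutting the convolution kernel off to the triangle 0 < τ ≤ t turns the variable upper limit into
an integral over the whole horizon, to which measurability of parameter integrals applies. -/
theorem aestronglyMeasurable_filterState (a : Polynomial ℝ)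
    (hu : Integrable u (horizon T)) (j : Fin a.natDegree) :
    AEStronglyMeasurable (fun t => filterState a u t j) (horizon T) := by
  have hs : MeasurableSet {z : ℝ × ℝ | 0 < z.2 ∧ z.2 ≤ z.1} :=
    (measurableSet_lt measurable_const measurable_snd).inter
      (measurableSet_le measurable_snd measurable_fst)
  have h1 : AEStronglyMeasurable ({z : ℝ × ℝ | 0 < z.2 ∧ z.2 ≤ z.1}.indicator fun z =>
      (NormedSpace.exp ((z.1 - z.2) • stateMatrix a)).mulVec (inputVector a) j * u z.2)
      ((horizon T).prod (horizon T)) := by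
    refine AEStronglyMeasurable.indicator (AEStronglyMeasurable.mul ?_ ?_) hs
    · exact ((continuous_impulse a j).comp
        (continuous_fst.sub continuous_snd)).aestronglyMeasurable
    · exact hu.aestronglyMeasurable.comp_snd
  refine h1.integral_prod_right'.congr ?_
  refine (ae_restrict_iff' measurableSet_Icc).2 (ae_of_all _ fun t ht => ?_)
  beta_reduce
  change _ = ∫ τ in (0 : ℝ)..t,
    (NormedSpace.exp ((t - τ) • stateMatrix a)).mulVec (inputVector a) j * u τ
  rw [intervalIntegral.integral_of_le ht.1,
    ← integral_indicator measurableSet_Ioc, ← integral_indicator measurableSet_Icc]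
  refine integral_congr_ae (ae_of_all _ fun τ => ?_)
  by_cases hτ : τ ∈ Ioc 0 t
  · have h2 : τ ∈ Icc 0 T := ⟨hτ.1.le, hτ.2.trans ht.2⟩
    simp only [indicator_of_mem hτ, indicator_of_mem h2]
    rw [indicator_of_mem (show (t, τ) ∈ {z : ℝ × ℝ | 0 < z.2 ∧ z.2 ≤ z.1} from hτ)]
  · rw [indicator_of_notMem hτ]
    by_cases h2 : τ ∈ Icc 0 T
    · simp only [indicator_of_mem h2]
      rw [indicator_of_notMem (show (t, τ) ∉ {z : ℝ × ℝ | 0 < z.2 ∧ z.2 ≤ z.1} from hτ)]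
    · simp only [indicator_of_notMem h2]

theorem aestronglyMeasurable_response (a : Polynomial ℝ) (hu : Integrable u (horizon T)) (i : ℕ) :
    AEStronglyMeasurable (response a i u) (horizon T) := by
  by_cases h : i < a.natDegree
  · have : response a i u = fun t => filterState a u t ⟨i, h⟩ := by
      ext t; simp [response, h]
    rw [this]
    exact aestronglyMeasurable_filterState a hu _
  · have : response a i u = fun t =>
        (u t - ∑ j : Fin a.natDegree, a.coeff j * filterState a u t j) * a.leadingCoeff⁻¹ := by
      ext t; simp [response, h, div_eq_mul_inv]
    rw [this]
    refine AEStronglyMeasurable.mul_const (hu.aestronglyMeasurable.sub ?_) _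
    exact Finset.aestronglyMeasurable_fun_sum _ fun j _ =>
      (aestronglyMeasurable_filterState a hu j).const_mul _

theorem memLp_response (a : Polynomial ℝ) (hu : MemLp u 2 (horizon T)) (i : ℕ) :
    MemLp (response a i u) 2 (horizon T) := by
  have hi : Integrable u (horizon T) := hu.integrable one_le_two
  obtain ⟨A, B, -, -, h⟩ := exists_response_bound a T
  have hg : MemLp (fun t => A * |u t| + B * ∫ τ in Icc (0 : ℝ) T, |u τ|) 2 (horizon T) :=
    (hu.abs.const_mul A).add (memLp_const _)
  refine hg.mono (aestronglyMeasurable_response a hi i) ?_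
  refine (ae_restrict_iff' measurableSet_Icc).2 (ae_of_all _ fun t ht => ?_)
  exact (h u hi t ht i).trans (le_abs_self _)

end Signals

/-! ### Continuity of the signature matrix in the signal. -/

section Signature

variable {nr nx nz nf dH dL dF : ℕ} {T : ℝ}

theorem memLp_signature (S : DAE nr nx nz nf dH dL dF) (x : PWC T nx) (l : Fin nr) :
    MemLp (fun τ => signature S x τ l) 2 (horizon T) := by
  obtain ⟨K, hK⟩ := S.lipschitz
  obtain ⟨C, hC⟩ := x.exists_bound
  have hm : AEStronglyMeasurable (fun τ => signature S x τ l) (horizon T) :=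
    ((EuclideanSpace.proj l).continuous.comp hK.continuous).comp_aestronglyMeasurable
      x.memLp.aestronglyMeasurable
  refine MemLp.of_bound hm (‖S.E 0‖ + K * C)
    ((ae_restrict_iff' measurableSet_Icc).2 (ae_of_all _ fun t ht => ?_))
  have h1 : ‖signature S x t l‖ ≤ ‖S.E (x.toFun t)‖ := PiLp.norm_apply_le _ l
  have h2 : ‖S.E (x.toFun t) - S.E 0‖ ≤ K * ‖x.toFun t - 0‖ := hK.norm_sub_le _ _
  rw [sub_zero] at h2
  have h3 := mul_le_mul_of_nonneg_left (hC t ht) K.2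
  have h4 := norm_le_norm_add_norm_sub' (S.E (x.toFun t)) (S.E 0)
  exact h1.trans (h4.trans (by gcongr; exact h2.trans h3))

theorem memLp_psi (S : DAE nr nx nz nf dH dL dF) (a : Polynomial ℝ) (dN : ℕ) (x : PWC T nx)
    (i : Fin (dN + 1) × Fin nr) : MemLp (fun t => psi S a dN x t i) 2 (horizon T) :=
  (memLp_response a (memLp_signature S x i.2) i.1).neg

/-- The response is linear and `E` is Lipschitz, so the difference at t is bounded by a multiple of
‖δ t‖ plus a multiple of the L¹-norm of δ. Passing from L¹ to L², and taking the L²-norm of a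
constant, each cost one factor κ, the square root of the length of the horizon. -/
theorem exists_psi_lipschitz (S : DAE nr nx nz nf dH dL dF) (a : Polynomial ℝ) (dN : ℕ) (T : ℝ)
    (i : Fin (dN + 1) × Fin nr) :
    ∃ C : ENNReal, C ≠ ⊤ ∧ ∀ x y : PWC T nx,
      eLpNorm ((fun t => psi S a dN x t i) - fun t => psi S a dN y t i) 2 (horizon T) ≤
        C * eLpNorm (x.toFun - y.toFun) 2 (horizon T) := by
  obtain ⟨K, hK⟩ := S.lipschitz
  obtain ⟨A, B, hA, hB, hAB⟩ := exists_response_bound a T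
  set κ : ENNReal := (horizon T) univ ^ (1 / (2 : ℝ))
  have hκ : κ ≠ ⊤ := ENNReal.rpow_ne_top_of_nonneg (by norm_num) (measure_ne_top _ _)
  refine ⟨ENNReal.ofReal (A * K) + ENNReal.ofReal (B * K) * κ * κ, ?_, fun x y => ?_⟩
  · exact ENNReal.add_ne_top.2 ⟨ENNReal.ofReal_ne_top,
      ENNReal.mul_ne_top (ENNReal.mul_ne_top ENNReal.ofReal_ne_top hκ) hκ⟩
  set δ : ℝ → EuclideanSpace ℝ (Fin nx) := x.toFun - y.toFun
  have hδ : MemLp δ 2 (horizon T) := x.memLp.sub y.memLp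
  have hδi : Integrable δ (horizon T) := hδ.integrable one_le_two
  have hu := (memLp_signature S x i.2).integrable one_le_two
  have hv := (memLp_signature S y i.2).integrable one_le_two
  have hw : ∀ t, |signature S x t i.2 - signature S y t i.2| ≤ K * ‖δ t‖ := fun t =>
    (PiLp.norm_apply_le (S.E (x.toFun t) - S.E (y.toFun t)) i.2).trans (hK.norm_sub_le _ _)
  set c : ℝ := B * K * ∫ τ in Icc (0 : ℝ) T, ‖δ τ‖
  have hc : 0 ≤ c := mul_nonneg (by positivity) (integral_nonneg fun _ => norm_nonneg _)
  have hpt : ∀ t ∈ Icc (0 : ℝ) T,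
      ‖((fun t => psi S a dN x t i) - fun t => psi S a dN y t i) t‖ ≤
        ((fun t => A * K * ‖δ t‖) + fun _ : ℝ => c) t := by
    intro t ht
    have h1 := hAB _ (hu.sub hv) t ht i.1
    have h2 : response a i.1
        ((fun τ => signature S x τ i.2) - fun τ => signature S y τ i.2) t = _ :=
      response_sub a hu hv ht i.1
    rw [h2] at h1
    simp only [Pi.sub_apply, Pi.add_apply, psi, Real.norm_eq_abs] at h1 ⊢
    rw [neg_sub_neg, abs_sub_comm]
    refine h1.trans (add_le_add ?_ ?_)
    · rw [mul_assoc]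
      exact mul_le_mul_of_nonneg_left (hw t) hA
    · change _ ≤ B * K * _
      rw [mul_assoc, ← integral_const_mul (K : ℝ)]
      refine mul_le_mul_of_nonneg_left ?_ hB
      exact integral_mono (hu.sub hv).abs (hδi.norm.const_mul _) hw
  have hnorm : ENNReal.ofReal (∫ τ in Icc (0 : ℝ) T, ‖δ τ‖) ≤ eLpNorm δ 2 (horizon T) * κ := by
    rw [ofReal_integral_norm_eq_lintegral_enorm hδi, ← eLpNorm_one_eq_lintegral_enorm]
    refine (eLpNorm_le_eLpNorm_mul_rpow_measure_univ (one_le_two) hδ.aestronglyMeasurable).trans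
      (le_of_eq ?_)
    norm_num [κ]
  calc _ ≤ eLpNorm ((fun t => A * K * ‖δ t‖) + fun _ : ℝ => c) 2 (horizon T) :=
        eLpNorm_mono_ae_real ((ae_restrict_iff' measurableSet_Icc).2 (ae_of_all _ hpt))
    _ ≤ eLpNorm (fun t => A * K * ‖δ t‖) 2 (horizon T) + eLpNorm (fun _ : ℝ => c) 2 (horizon T) :=
        eLpNorm_add_le (hδ.norm.const_mul _).aestronglyMeasurable
          aestronglyMeasurable_const one_le_two
    _ ≤ ENNReal.ofReal (A * K) * eLpNorm δ 2 (horizon T) +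
          ENNReal.ofReal (B * K) * (eLpNorm δ 2 (horizon T) * κ) * κ := by
        refine add_le_add (le_of_eq ?_) ?_
        · have : (fun t => A * K * ‖δ t‖) = (A * K) • fun t => ‖δ t‖ := rfl
          rw [this, eLpNorm_const_smul, eLpNorm_norm, Real.enorm_of_nonneg (by positivity)]
        · rw [eLpNorm_const' _ (by norm_num) (by norm_num), Real.enorm_of_nonneg hc,
            ENNReal.ofReal_mul (by positivity)]
          norm_num only [ENNReal.toReal_ofNat]
          gcongr
    _ = _ := by ring

theorem continuous_toLp_psi (S : DAE nr nx nz nf dH dL dF) (a : Polynomial ℝ) (dN : ℕ) (T : ℝ)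
    (i : Fin (dN + 1) × Fin nr) :
    Continuous fun x : PWC T nx => (memLp_psi S a dN x i).toLp _ := by
  obtain ⟨C, hC, h⟩ := exists_psi_lipschitz S a dN T i
  refine continuous_iff_continuousAt.2 fun y => ?_
  refine tendsto_iff_edist_tendsto_0.2 ?_
  have h1 : Tendsto (fun x : PWC T nx => C * edist x.toL2 y.toL2) (𝓝 y) (𝓝 (C * 0)) :=
    ENNReal.Tendsto.const_mul (tendsto_iff_edist_tendsto_0.1
      (continuous_induced_dom.continuousAt (f := PWC.toL2))) (Or.inr hC)
  rw [mul_zero] at h1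
  refine tendsto_of_tendsto_of_tendsto_of_le_of_le tendsto_const_nhds h1 (fun _ => zero_le)
    fun x => ?_
  simp only [PWC.toL2, Lp.edist_toLp_toLp]
  exact h x y

/-- The entries are L² inner products of components of ψ_x, which depend continuously on x. -/
theorem continuous_signatureMatrix (S : DAE nr nx nz nf dH dL dF) (a : Polynomial ℝ) (dN : ℕ)
    (hT : 0 ≤ T) (i j : Fin (dN + 1) × Fin nr) :
    Continuous fun x : PWC T nx => signatureMatrix S a dN x i j := by
  have h : ∀ x : PWC T nx, signatureMatrix S a dN x i j =
      inner ℝ ((memLp_psi S a dN x i).toLp _) ((memLp_psi S a dN x j).toLp _) := by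
    intro x
    rw [L2.inner_def]
    simp only [signatureMatrix, Matrix.of_apply]
    rw [intervalIntegral.integral_of_le hT, ← integral_Icc_eq_integral_Ioc]
    refine integral_congr_ae ?_
    filter_upwards [(memLp_psi S a dN x i).coeFn_toLp, (memLp_psi S a dN x j).coeFn_toLp]
      with t h1 h2
    rw [h1, h2]
    simp [mul_comm]
  simp only [h]
  exact (continuous_toLp_psi S a dN T i).inner (continuous_toLp_psi S a dN T j)

theorem intervalIntegrable_psi_mul (S : DAE nr nx nz nf dH dL dF) (a : Polynomial ℝ) (dN : ℕ)
    (hT : 0 ≤ T) (x : PWC T nx) (i j : Fin (dN + 1) × Fin nr) :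
    IntervalIntegrable (fun t => psi S a dN x t i * psi S a dN x t j) volume 0 T := by
  rw [intervalIntegrable_iff_integrableOn_Icc_of_le hT]
  exact (memLp_psi S a dN x i).integrable_mul (memLp_psi S a dN x j)

/-- The bridge from dynamics to optimization: beyond it, signals matter only through Q_x. -/
theorem l2Norm_residual_sq (S : DAE nr nx nz nf dH dL dF) (a : Polynomial ℝ) {dN : ℕ}
    (hT : 0 ≤ T) (N : Coeffs dN nr) (x : PWC T nx) :
    l2Norm T (residual S a N x) ^ 2 = quadForm (signatureMatrix S a dN x) N := by
  have hres : ∀ t, residual S a N x t = ∑ i, N i * psi S a dN x t i := by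
    intro t
    simp only [residual, psi, mul_neg, Finset.sum_neg_distrib, Fintype.sum_prod_type]
  rw [l2Norm, Real.sq_sqrt (intervalIntegral.integral_nonneg hT fun _ _ => sq_nonneg _)]
  have hsq : ∀ t, residual S a N x t ^ 2 =
      ∑ i, ∑ j, N i * N j * (psi S a dN x t i * psi S a dN x t j) := by
    intro t
    rw [hres, sq, Finset.sum_mul_sum]
    refine Finset.sum_congr rfl fun i _ => Finset.sum_congr rfl fun j _ => by ring
  simp only [hsq]
  have hint := fun i j => (intervalIntegrable_psi_mul S a dN hT x i j).const_mul (N i * N j)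
  rw [intervalIntegral.integral_finsetSum fun i _ => by
    have h := IntervalIntegrable.sum Finset.univ fun j _ => hint i j
    rwa [Finset.sum_fn] at h]
  simp only [quadForm, dotProduct, Matrix.mulVec, signatureMatrix, Matrix.of_apply,
    Finset.mul_sum]
  refine Finset.sum_congr rfl fun i _ => ?_
  rw [intervalIntegral.integral_finsetSum fun j _ => hint i j]
  refine Finset.sum_congr rfl fun j _ => ?_
  rw [intervalIntegral.integral_const_mul]
  ring

end Signature

/-! ### Double counting over subsets of the samples. -/

section Counting

variable {Ω : Type*} [MeasurableSpace Ω] (P : Measure Ω) [IsProbabilityMeasure P] {n : ℕ}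

/-- If, once the coordinates in `T` are fixed, a set confines all remaining coordinates to a set
of measure at most `p`, then its measure is at most `p ^ (n - #T)`. -/
theorem pi_le_pow_of_sections (T : Finset (Fin n)) {A : Set (Fin n → Ω)} (hA : MeasurableSet A)
    {p : ENNReal}
    (hsec : ∀ y : {i // i ∈ T} → Ω, ∃ G, P G ≤ p ∧
      ∀ ω ∈ A, (∀ i : {i // i ∈ T}, ω i = y i) → ∀ i ∉ T, ω i ∈ G) :
    Measure.pi (fun _ : Fin n => P) A ≤ p ^ (n - T.card) := by
  have hmp := (measurePreserving_piEquivPiSubtypeProd (fun _ : Fin n => P) (fun i => i ∈ T))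
  set e := MeasurableEquiv.piEquivPiSubtypeProd (fun _ : Fin n => Ω) (fun i => i ∈ T)
  have hmp' := hmp.symm e
  rw [← hmp'.measure_preimage hA.nullMeasurableSet,
    Measure.prod_apply (e.symm.measurable hA)]
  -- Fubini: with the coordinates in `T` frozen at `y`, the section lies in a box with all sides
  -- `G`.
  refine (lintegral_mono (g := fun _ => p ^ (n - T.card)) fun y => ?_).trans (by simp)
  obtain ⟨G, hG, hAG⟩ := hsec y
  calc _ ≤ (Measure.pi fun _ : {i // i ∉ T} => P) (Set.univ.pi fun _ => G) := by
        refine measure_mono fun z hz i _ => ?_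
        have hz' : e.symm (y, z) ∈ A := hz
        have hy : e (e.symm (y, z)) = (y, z) := e.apply_symm_apply _
        have h1 := hAG _ hz' (fun i => congrFun (congrArg Prod.fst hy) i) i i.2
        rwa [show e.symm (y, z) i = z i from congrFun (congrArg Prod.snd hy) i] at h1
    _ = P G ^ (n - T.card) := by
        rw [Measure.pi_pi, Finset.prod_const]
        congr 1
        rw [Finset.card_univ, Fintype.card_subtype_compl]
        simp
    _ ≤ _ := pow_le_pow_left' hG _

/-- Double counting: a set whose points are all certified by every `t`-set of coordinates that
contains some `d`-set is no larger than a proportion of the certified sets. -/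
theorem measure_mul_choose_le {d t : ℕ} (hdt : d ≤ t) (htn : t ≤ n)
    {B : Set (Fin n → Ω)} (hB : MeasurableSet B)
    {A : Finset (Fin n) → Set (Fin n → Ω)} (hA : ∀ T, MeasurableSet (A T))
    (hcover : ∀ ω ∈ B, ∃ I : Finset (Fin n), I.card = d ∧ ∀ T, I ⊆ T → ω ∈ A T)
    {p : ENNReal}
    (hsec : ∀ T, ∀ y : {i // i ∈ T} → Ω, ∃ G, P G ≤ p ∧
      ∀ ω ∈ A T, (∀ i : {i // i ∈ T}, ω i = y i) → ∀ i ∉ T, ω i ∈ G) :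
    Measure.pi (fun _ : Fin n => P) B * ((n - d).choose (n - t) : ENNReal)
      ≤ (n.choose (n - t) : ENNReal) * p ^ (n - t) := by
  classical
  set μ := Measure.pi (fun _ : Fin n => P)
  set F := Finset.powersetCard t (Finset.univ : Finset (Fin n))
  -- The `t`-sets containing `I` are the unions I ∪ J with J a (t - d)-subset of the complement of
  -- I; there are C(n - d, t - d) = C(n - d, n - t) of them.
  have hlow : ∀ ω ∈ B, ((n - d).choose (n - t) : ENNReal) ≤
      ∑ T ∈ F, (A T).indicator (fun _ => (1 : ENNReal)) ω := by
    intro ω hω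
    obtain ⟨I, hI, hIA⟩ := hcover ω hω
    have hinj : (Finset.powersetCard (t - d) (Finset.univ \ I)).card = (n - d).choose (n - t) := by
      rw [Finset.card_powersetCard, Finset.card_sdiff_of_subset (Finset.subset_univ _), hI,
        Finset.card_univ, Fintype.card_fin, ← Nat.choose_symm (by omega)]
      congr 1
      omega
    have hdisj : ∀ J ∈ Finset.powersetCard (t - d) (Finset.univ \ I), Disjoint I J := by
      intro J hJ
      exact Finset.disjoint_sdiff.mono_right (Finset.mem_powersetCard.1 hJ).1
    calc ((n - d).choose (n - t) : ENNReal)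
        = ∑ J ∈ Finset.powersetCard (t - d) (Finset.univ \ I), (1 : ENNReal) := by
          rw [Finset.sum_const, hinj, nsmul_eq_mul, mul_one]
      _ = ∑ T ∈ (Finset.powersetCard (t - d) (Finset.univ \ I)).image (fun J => I ∪ J),
            (1 : ENNReal) := by
          rw [Finset.sum_image]
          intro J hJ J' hJ' h
          have h1 := Finset.union_sdiff_cancel_left (hdisj J hJ)
          have h2 := Finset.union_sdiff_cancel_left (hdisj J' hJ')
          simp only at h
          rw [← h1, h, h2]
      _ = ∑ T ∈ (Finset.powersetCard (t - d) (Finset.univ \ I)).image (fun J => I ∪ J),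
            (A T).indicator (fun _ => (1 : ENNReal)) ω := by
          refine Finset.sum_congr rfl fun T hT => ?_
          obtain ⟨J, -, rfl⟩ := Finset.mem_image.1 hT
          rw [indicator_of_mem (hIA _ Finset.subset_union_left)]
      _ ≤ _ := by
          refine Finset.sum_le_sum_of_subset fun T hT => ?_
          obtain ⟨J, hJ, rfl⟩ := Finset.mem_image.1 hT
          refine Finset.mem_powersetCard.2 ⟨Finset.subset_univ _, ?_⟩
          rw [Finset.card_union_of_disjoint (hdisj J hJ), hI, (Finset.mem_powersetCard.1 hJ).2]
          omega
  calc μ B * ((n - d).choose (n - t) : ENNReal)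
      = ∫⁻ _ in B, ((n - d).choose (n - t) : ENNReal) ∂μ := by
        rw [lintegral_const, Measure.restrict_apply_univ, mul_comm]
    _ ≤ ∫⁻ ω in B, ∑ T ∈ F, (A T).indicator (fun _ => (1 : ENNReal)) ω ∂μ :=
        setLIntegral_mono' hB hlow
    _ ≤ ∫⁻ ω, ∑ T ∈ F, (A T).indicator (fun _ => (1 : ENNReal)) ω ∂μ :=
        setLIntegral_le_lintegral _ _
    _ = ∑ T ∈ F, μ (A T) := by
        rw [lintegral_finsetSum _ fun T _ => measurable_const.indicator (hA T)]
        exact Finset.sum_congr rfl fun T _ => lintegral_indicator_one (hA T)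
    _ ≤ ∑ T ∈ F, p ^ (n - t) := by
        refine Finset.sum_le_sum fun T hT => ?_
        rw [← (Finset.mem_powersetCard.1 hT).2]
        exact pi_le_pow_of_sections P T (hA T) (hsec T)
    _ = _ := by
        rw [Finset.sum_const, Finset.card_powersetCard, Finset.card_univ, Fintype.card_fin,
          nsmul_eq_mul, Nat.choose_symm htn]

end Counting

/-- C(n - d, s) / C(n, s) is the product of the factors 1 - d / (n - k) over k < s, each at least 1
- η with η = d / (t + 1), because n - k ≥ t + 1. The even split serves both halves of the exponent:
s ≥ n / 2 gives sε ≥ L + d, and s ≤ t + 1 gives sη ≤ d, so s(ε - η) ≥ L. -/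
theorem choose_mul_pow_lt {n d s t : ℕ} {ε L : ℝ} (hε₀ : 0 < ε) (hε₁ : ε < 1) (hL : 0 ≤ L)
    (hd : 1 ≤ d) (hst : s + t = n) (hts : t ≤ s) (hs : s ≤ t + 1)
    (hn : 2 / ε * (L + d) ≤ n) :
    (n.choose s : ℝ) * (1 - ε) ^ s < Real.exp (-L) * ((n - d).choose s : ℝ) := by
  have hd' : (1 : ℝ) ≤ d := by exact_mod_cast hd
  have hn' : 2 * (L + d) ≤ ε * n := by
    rw [div_mul_eq_mul_div, div_le_iff₀ hε₀] at hn; linarith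
  have hn0 : (0 : ℝ) < n := by
    by_contra h
    nlinarith
  have hnst : (n : ℝ) = s + t := by exact_mod_cast hst.symm
  have hst1 : (s : ℝ) ≤ t + 1 := by exact_mod_cast hs
  have hts1 : (t : ℝ) ≤ s := by exact_mod_cast hts
  have hs0 : s ≠ 0 := by
    rintro rfl
    have : 0 < n := by exact_mod_cast hn0
    omega
  have h2d : 2 * (d : ℝ) < n := by nlinarith
  have hdt : d ≤ t := by
    have : 2 * d < n := by exact_mod_cast h2d
    omega
  have hdt' : (d : ℝ) ≤ t := by exact_mod_cast hdt
  set η : ℝ := d / (t + 1) with hη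
  have ht1 : (0 : ℝ) < t + 1 := by positivity
  have hη1 : η < 1 := by rw [hη, div_lt_one ht1]; linarith
  have hη0 : 0 < η := by positivity
  have hηε : η < ε := by rw [hη, div_lt_iff₀ ht1]; nlinarith
  -- The quotient is 1 - x with x = (ε - η) / (1 - η) > 0; the strict bound 1 - x < exp(-x) is what
  -- makes the conclusion strict.
  have hexp : (1 - ε) / (1 - η) < Real.exp (-(ε - η)) := by
    have h1 : (0 : ℝ) < 1 - η := by linarith
    have hx : (ε - η) ≤ (ε - η) / (1 - η) := by
      rw [le_div_iff₀ h1]; nlinarith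
    have h2 : (1 - ε) / (1 - η) = -((ε - η) / (1 - η)) + 1 := by field_simp; ring
    rw [h2]
    refine (Real.add_one_lt_exp ?_).trans_le (Real.exp_le_exp.2 (by linarith))
    have : 0 < (ε - η) / (1 - η) := div_pos (by linarith) h1
    linarith
  have hratio : ∀ k ≤ s, (n.descFactorial k : ℝ) * (1 - η) ^ k ≤ ((n - d).descFactorial k : ℝ) := by
    intro k hk
    induction k with
    | zero => simp
    | succ k ih =>
      have ih := ih (by omega)
      rw [Nat.descFactorial_succ, Nat.descFactorial_succ]
      push_cast
      have hc : ((n - k : ℕ) : ℝ) = n - k := by rw [Nat.cast_sub (by omega)]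
      have hc2 : ((n - d - k : ℕ) : ℝ) = n - d - k := by
        rw [Nat.cast_sub (by omega), Nat.cast_sub (by omega)]
      rw [hc, hc2]
      have hk' : (k : ℝ) + 1 ≤ s := by exact_mod_cast hk
      have hstep : ((n : ℝ) - k) * (1 - η) ≤ n - d - k := by
        have : (d : ℝ) = η * (t + 1) := by rw [hη]; field_simp
        nlinarith
      have hp : 0 ≤ ((n : ℝ) - k) * (1 - η) := mul_nonneg (by linarith) (by linarith)
      calc ((n : ℝ) - k) * (n.descFactorial k) * (1 - η) ^ (k + 1)
          = (((n : ℝ) - k) * (1 - η)) * ((n.descFactorial k) * (1 - η) ^ k) := by ring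
        _ ≤ (n - d - k) * ((n - d).descFactorial k : ℝ) :=
          mul_le_mul hstep ih (by have : (0:ℝ) ≤ 1 - η := by linarith
                                  positivity) (hp.trans hstep)
  have hch : (n.choose s : ℝ) * (1 - η) ^ s ≤ ((n - d).choose s : ℝ) := by
    have := hratio s le_rfl
    rw [Nat.descFactorial_eq_factorial_mul_choose, Nat.descFactorial_eq_factorial_mul_choose] at this
    push_cast at this
    rw [mul_assoc] at this
    exact le_of_mul_le_mul_left this (by exact_mod_cast Nat.factorial_pos s)
  have hpos : (0 : ℝ) < n.choose s := by exact_mod_cast Nat.choose_pos (by omega)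
  have h1η : (0 : ℝ) < 1 - η := by linarith
  have hpow : (1 - ε) ^ s < Real.exp (-L) * (1 - η) ^ s := by
    have h1 : ((1 - ε) / (1 - η)) ^ s < Real.exp (-(ε - η)) ^ s :=
      pow_lt_pow_left₀ hexp (div_nonneg (by linarith) h1η.le) hs0
    have h2 : Real.exp (-(ε - η)) ^ s ≤ Real.exp (-L) := by
      rw [← Real.exp_nat_mul]
      refine Real.exp_le_exp.2 ?_
      have h3 : (s : ℝ) * η ≤ d := by
        rw [hη, mul_div_assoc', div_le_iff₀ ht1]; nlinarith
      nlinarith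
    rw [div_pow, div_lt_iff₀ (by positivity)] at h1
    exact h1.trans_le (mul_le_mul_of_nonneg_right h2 (by positivity))
  calc (n.choose s : ℝ) * (1 - ε) ^ s < n.choose s * (Real.exp (-L) * (1 - η) ^ s) :=
        mul_lt_mul_of_pos_left hpow hpos
    _ = Real.exp (-L) * (n.choose s * (1 - η) ^ s) := by ring
    _ ≤ _ := mul_le_mul_of_nonneg_left hch (Real.exp_pos _).le

/-! ### Convex min-max programs with a lexicographic tie-break. -/

section LexOptimal

variable {ι κ : Type*} [Fintype ι] {K : Set (ι → ℝ)} {f : κ → (ι → ℝ) → ℝ}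

/-- `(v, γ)` is minimal, in the lexicographic order of `(γ, v ⬝ᵥ v)`, among the pairs that are
feasible for the epigraph form of minimizing `max_{i ∈ T} f i` over `K`. -/
def IsLexOptimal (K : Set (ι → ℝ)) (f : κ → (ι → ℝ) → ℝ) (T : Finset κ) (v : ι → ℝ) (γ : ℝ) :
    Prop :=
  ∀ w ∈ K, ∀ g, (∀ i ∈ T, f i w ≤ g) → ¬ (g < γ ∨ g = γ ∧ w ⬝ᵥ w < v ⬝ᵥ v)

/-- Feasibility of (v, γ) is not part of the notion, so a larger set of constraints only removes
competitors. -/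
theorem IsLexOptimal.mono {T T' : Finset κ} {v : ι → ℝ} {γ : ℝ} (h : IsLexOptimal K f T v γ)
    (hT : T ⊆ T') : IsLexOptimal K f T' v γ :=
  fun w hw g hg => h w hw g fun i hi => hg i (hT hi)

/-- The parallelogram-type identity behind the convexity of `v ↦ v ⬝ᵥ v`. -/
theorem dotProduct_self_combo (a b : ℝ) (hab : a + b = 1) (v w : ι → ℝ) :
    (a • v + b • w) ⬝ᵥ (a • v + b • w) =
      a * (v ⬝ᵥ v) + b * (w ⬝ᵥ w) - a * b * ((v - w) ⬝ᵥ (v - w)) := by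
  obtain rfl : b = 1 - a := by linarith
  simp only [dotProduct, Finset.mul_sum, ← Finset.sum_add_distrib, ← Finset.sum_sub_distrib]
  refine Finset.sum_congr rfl fun i _ => ?_
  simp only [Pi.add_apply, Pi.smul_apply, Pi.sub_apply, smul_eq_mul]
  ring

theorem dotProduct_self_nonneg' (v : ι → ℝ) : 0 ≤ v ⬝ᵥ v :=
  Finset.sum_nonneg fun _ _ => mul_self_nonneg _

/-- Two distinct optima would tie in value and in norm, and their midpoint would be feasible and
strictly shorter. Hence the optimum for `T` depends only on the constraints in `T`. -/
theorem IsLexOptimal.unique (hK : Convex ℝ K) (hf : ∀ i, ConvexOn ℝ univ (f i))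
    {T : Finset κ} {v v' : ι → ℝ} {γ γ' : ℝ} (h : IsLexOptimal K f T v γ)
    (h' : IsLexOptimal K f T v' γ') (hv : v ∈ K) (hv' : v' ∈ K)
    (hfv : ∀ i ∈ T, f i v ≤ γ) (hfv' : ∀ i ∈ T, f i v' ≤ γ') : v = v' ∧ γ = γ' := by
  have h1 := h v' hv' γ' hfv'
  have h2 := h' v hv γ hfv
  push Not at h1 h2
  obtain rfl : γ = γ' := le_antisymm h1.1 h2.1
  have h3 := le_antisymm (h1.2 rfl) (h2.2 rfl)
  refine ⟨?_, rfl⟩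
  by_contra hne
  have hpos : 0 < (v - v') ⬝ᵥ (v - v') :=
    lt_of_le_of_ne (dotProduct_self_nonneg' _) fun h0 =>
      hne (sub_eq_zero.1 (dotProduct_self_eq_zero.1 h0.symm))
  refine h (((1 : ℝ) / 2) • v + ((1 : ℝ) / 2) • v')
    (hK hv hv' (by norm_num) (by norm_num) (by norm_num)) γ (fun i hi => ?_) (Or.inr ⟨rfl, ?_⟩)
  · have := (hf i).2 (mem_univ v) (mem_univ v') (show (0 : ℝ) ≤ 1 / 2 by norm_num)
      (show (0 : ℝ) ≤ 1 / 2 by norm_num) (by norm_num)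
    simp only [smul_eq_mul] at this
    linarith [hfv i hi, hfv' i hi]
  · rw [dotProduct_self_combo _ _ (by norm_num)]
    linarith

/-- Without `K`, this is an open half-space together with an open ball in its bounding hyperplane.
-/
theorem convex_lexLower (hK : Convex ℝ K) (v : ι → ℝ) (γ : ℝ) :
    Convex ℝ {z : (ι → ℝ) × ℝ | z.1 ∈ K ∧ (z.2 < γ ∨ z.2 = γ ∧ z.1 ⬝ᵥ z.1 < v ⬝ᵥ v)} := by
  rintro ⟨w, g⟩ ⟨hw, hg⟩ ⟨w', g'⟩ ⟨hw', hg'⟩ a b ha hb hab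
  refine ⟨hK hw hw' ha hb hab, ?_⟩
  rcases ha.eq_or_lt with rfl | ha
  · obtain rfl : b = 1 := by linarith
    simpa using hg'
  rcases hb.eq_or_lt with rfl | hb
  · obtain rfl : a = 1 := by linarith
    simpa using hg
  obtain rfl : b = 1 - a := by linarith
  simp only [Prod.fst_add, Prod.smul_fst, Prod.snd_add, Prod.smul_snd, smul_eq_mul] at *
  rcases hg with h1 | ⟨rfl, h1⟩ <;> rcases hg' with h2 | ⟨h2, h3⟩
  · left; nlinarith
  · left; nlinarith
  · left; nlinarith
  · right
    refine ⟨by rw [h2]; ring, ?_⟩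
    rw [dotProduct_self_combo _ _ hab]
    have := mul_nonneg (mul_nonneg ha.le hb.le) (dotProduct_self_nonneg' (w - w'))
    nlinarith

/-- By Helly's theorem, at most `dim + 1` of the constraints determine the optimum. -/
theorem IsLexOptimal.exists_basis [Fintype κ] (hK : Convex ℝ K)
    (hf : ∀ i, ConvexOn ℝ univ (f i)) {v : ι → ℝ} {γ : ℝ} (hv : v ∈ K) (hfv : ∀ i, f i v ≤ γ)
    (h : IsLexOptimal K f Finset.univ v γ) (hcard : Fintype.card ι + 1 ≤ Fintype.card κ) :
    ∃ I : Finset κ, I.card = Fintype.card ι + 1 ∧ ∀ T, I ⊆ T → IsLexOptimal K f T v γ := by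
  classical
  by_contra hcon
  push Not at hcon
  have hI : ∀ I : Finset κ, I.card = Fintype.card ι + 1 → ¬ IsLexOptimal K f I v γ := by
    intro I hI hopt
    obtain ⟨T, hT, hT'⟩ := hcon I hI
    exact hT' (hopt.mono hT)
  -- `none` stands for the points that beat (v, γ), `some i` for the epigraph of `f i` over `K`. The
  -- dimension is `card ι + 1`, so Helly needs every `card ι + 2` of these sets to meet. With `none`
  -- among them, they meet because the remaining constraints do not certify the optimum; otherwise
  -- they meet at (v, γ). A point common to all contradicts optimality.
  let C : Option κ → Set ((ι → ℝ) × ℝ) := fun o => o.elim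
    {z | z.1 ∈ K ∧ (z.2 < γ ∨ z.2 = γ ∧ z.1 ⬝ᵥ z.1 < v ⬝ᵥ v)}
    (fun i => {z | z.1 ∈ K ∧ f i z.1 ≤ z.2})
  have hdim : Module.finrank ℝ ((ι → ℝ) × ℝ) = Fintype.card ι + 1 := by simp
  have hne : (⋂ o ∈ (Finset.univ : Finset (Option κ)), C o).Nonempty := by
    refine Convex.helly_theorem (𝕜 := ℝ) ?_ ?_ ?_
    · rw [hdim, Finset.card_univ, Fintype.card_option]; omega
    · rintro (_ | i) -
      · exact convex_lexLower hK v γ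
      · rintro ⟨w, g⟩ ⟨hw, hg⟩ ⟨w', g'⟩ ⟨hw', hg'⟩ a b ha hb hab
        refine ⟨hK hw hw' ha hb hab, ?_⟩
        refine ((hf i).2 (mem_univ w) (mem_univ w') ha hb hab).trans ?_
        exact add_le_add (mul_le_mul_of_nonneg_left hg ha) (mul_le_mul_of_nonneg_left hg' hb)
    · intro J _ hJ
      by_cases hn : none ∈ J
      · have hJc : J.eraseNone.card = Fintype.card ι + 1 := by
          rw [Finset.card_eraseNone_of_mem hn, hJ, hdim]; rfl
        have := hI _ hJc
        simp only [IsLexOptimal] at this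
        push Not at this
        obtain ⟨w, hw, g, hg, hlt⟩ := this
        refine ⟨(w, g), mem_iInter₂.2 ?_⟩
        rintro (_ | i) ho
        · exact ⟨hw, hlt⟩
        · exact ⟨hw, hg i (Finset.mem_eraseNone.2 ho)⟩
      · refine ⟨(v, γ), mem_iInter₂.2 ?_⟩
        rintro (_ | i) ho
        · exact absurd ho hn
        · exact ⟨hv, hfv i⟩
  obtain ⟨⟨w, g⟩, hz⟩ := hne
  rw [mem_iInter₂] at hz
  have h0 := hz none (Finset.mem_univ _)
  exact h w h0.1 g (fun i _ => (hz (some i) (Finset.mem_univ _)).2) h0.2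

end LexOptimal

/-! ### Measurability of lexicographic optimality. -/

section Measurability

variable {Ω : Type*} [MeasurableSpace Ω]

/-- A continuous function attains its minimum on a compact set, so it is ≤ 0 somewhere exactly if it
falls below every 1 / (k + 1) on a countable dense subset. -/
theorem measurableSet_exists_mem_le {X : Type*} [TopologicalSpace X]
    [SecondCountableTopology X] {K : Set X} (hK : IsCompact K) {F : Ω → X → ℝ}
    (hFm : ∀ w, Measurable fun ω => F ω w) (hFc : ∀ ω, Continuous (F ω)) :
    MeasurableSet {ω | ∃ w ∈ K, F ω w ≤ 0} := by
  obtain ⟨D, hDc, hDd⟩ := TopologicalSpace.exists_countable_dense K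
  have : {ω | ∃ w ∈ K, F ω w ≤ 0} =
      ⋂ k : ℕ, ⋃ w ∈ D, {ω | F ω (w : X) < 1 / ((k : ℝ) + 1)} := by
    ext ω
    simp only [mem_ofPred_eq, mem_iInter, mem_iUnion, exists_prop]
    constructor
    · rintro ⟨w, hw, hle⟩ k
      have hopen : IsOpen {z : K | F ω z < 1 / ((k : ℝ) + 1)} :=
        isOpen_lt ((hFc ω).comp continuous_subtype_val) continuous_const
      obtain ⟨z, hz, hzD⟩ := hDd.inter_open_nonempty _ hopen
        ⟨⟨w, hw⟩, lt_of_le_of_lt hle (by positivity)⟩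
      exact ⟨z, hzD, hz⟩
    · intro h
      have hne : K.Nonempty := (h 0).elim fun z _ => ⟨z, z.2⟩
      obtain ⟨w, hw, hmin⟩ := hK.exists_isMinOn hne (hFc ω).continuousOn
      refine ⟨w, hw, le_of_forall_pos_lt_add fun δ hδ => ?_⟩
      obtain ⟨k, hk⟩ := exists_nat_one_div_lt hδ
      obtain ⟨z, -, hz⟩ := h k
      have h1 : F ω w ≤ F ω z := hmin z.2
      linarith
  rw [this]
  exact MeasurableSet.iInter fun k => MeasurableSet.biUnion hDc fun w _ =>
    measurableSet_lt (hFm w) measurable_const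

variable {ι κ : Type*} [Fintype ι] {K : Set (ι → ℝ)}

/-- Non-optimality means that a better competitor exists. Exhausting `K` by balls of radius R,
strict inequalities by gaps 1 / (k + 1), and merging the constraints into a sum of positive parts
gives a countable union of existence statements over compact sets: `F₁` for a smaller value, `F₂`
for a tie with smaller norm. -/
theorem measurableSet_isLexOptimal (hK : IsClosed K) {f : Ω → κ → (ι → ℝ) → ℝ}
    (hfm : ∀ i w, Measurable fun ω => f ω i w) (hfc : ∀ ω i, Continuous (f ω i))
    (T : Finset κ) {v : Ω → ι → ℝ} {γ : Ω → ℝ} (hv : Measurable v) (hγ : Measurable γ) :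
    MeasurableSet {ω | IsLexOptimal K (f ω) T (v ω) (γ ω)} := by
  have hcpt : ∀ R : ℕ, IsCompact (K ∩ Metric.closedBall 0 (R : ℝ)) := fun R =>
    (isCompact_closedBall _ _).inter_left hK
  let F₁ : ℕ → Ω → (ι → ℝ) → ℝ := fun k ω w =>
    ∑ i ∈ T, max (f ω i w - (γ ω - 1 / ((k : ℝ) + 1))) 0
  let F₂ : ℕ → Ω → (ι → ℝ) → ℝ := fun k ω w =>
    max (w ⬝ᵥ w - (v ω ⬝ᵥ v ω - 1 / ((k : ℝ) + 1))) 0 + ∑ i ∈ T, max (f ω i w - γ ω) 0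
  have hdotc : Continuous fun w : ι → ℝ => w ⬝ᵥ w := continuous_id.dotProduct continuous_id
  have hsum : ∀ (ω : Ω) (w : ι → ℝ) (c : ℝ),
      ∑ i ∈ T, max (f ω i w - c) 0 ≤ 0 ↔ ∀ i ∈ T, f ω i w ≤ c := by
    intro ω w c
    rw [(Finset.sum_nonneg fun i _ => le_max_right _ _).ge_iff_eq',
      Finset.sum_eq_zero_iff_of_nonneg fun i _ => le_max_right _ _]
    simp
  have h₁ : ∀ k R : ℕ, MeasurableSet {ω | ∃ w ∈ K ∩ Metric.closedBall 0 (R : ℝ), F₁ k ω w ≤ 0} :=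
    fun k R => measurableSet_exists_mem_le (hcpt R)
      (fun w => Finset.measurable_fun_sum _ fun i _ =>
        ((hfm i w).sub (hγ.sub_const _)).max measurable_const)
      (fun ω => continuous_finsetSum _ fun i _ => ((hfc ω i).sub continuous_const).max
        continuous_const)
  have h₂ : ∀ k R : ℕ, MeasurableSet {ω | ∃ w ∈ K ∩ Metric.closedBall 0 (R : ℝ), F₂ k ω w ≤ 0} :=
    fun k R => measurableSet_exists_mem_le (hcpt R)
      (fun w => ((measurable_const.sub ((hdotc.measurable.comp hv).sub_const _)).max
        measurable_const).add (Finset.measurable_fun_sum _ fun i _ =>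
        ((hfm i w).sub hγ).max measurable_const))
      (fun ω => ((hdotc.sub continuous_const).max continuous_const).add
        (continuous_finsetSum _ fun i _ => ((hfc ω i).sub continuous_const).max
        continuous_const))
  have heq : {ω | IsLexOptimal K (f ω) T (v ω) (γ ω)}ᶜ =
      (⋃ k : ℕ, ⋃ R : ℕ, {ω | ∃ w ∈ K ∩ Metric.closedBall 0 (R : ℝ), F₁ k ω w ≤ 0}) ∪
      (⋃ k : ℕ, ⋃ R : ℕ, {ω | ∃ w ∈ K ∩ Metric.closedBall 0 (R : ℝ), F₂ k ω w ≤ 0}) := by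
    ext ω
    simp only [mem_compl_iff, mem_ofPred_eq, mem_union, mem_iUnion, IsLexOptimal]
    push Not
    constructor
    · rintro ⟨w, hw, g, hg, h⟩
      obtain ⟨R, hR⟩ := exists_nat_ge ‖w‖
      have hwR : w ∈ K ∩ Metric.closedBall 0 (R : ℝ) := ⟨hw, by simpa using hR⟩
      rcases h with h | ⟨rfl, h⟩
      · obtain ⟨k, hk⟩ := exists_nat_one_div_lt (sub_pos.2 h)
        exact Or.inl ⟨k, R, w, hwR, (hsum _ _ _).2 fun i hi => (hg i hi).trans (by linarith)⟩
      · obtain ⟨k, hk⟩ := exists_nat_one_div_lt (sub_pos.2 h)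
        refine Or.inr ⟨k, R, w, hwR, ?_⟩
        have h1 := (hsum ω w (γ ω)).2 hg
        have h2 : max (w ⬝ᵥ w - (v ω ⬝ᵥ v ω - 1 / ((k : ℝ) + 1))) 0 ≤ 0 :=
          max_le (by linarith) le_rfl
        exact add_nonpos h2 h1
    · rintro (⟨k, R, w, hw, h⟩ | ⟨k, R, w, hw, h⟩)
      · refine ⟨w, hw.1, _, (hsum _ _ _).1 h, Or.inl ?_⟩
        have : (0 : ℝ) < 1 / ((k : ℝ) + 1) := by positivity
        linarith
      · have h1 : 0 ≤ ∑ i ∈ T, max (f ω i w - γ ω) 0 :=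
          Finset.sum_nonneg fun i _ => le_max_right _ _
        have h2 : 0 ≤ max (w ⬝ᵥ w - (v ω ⬝ᵥ v ω - 1 / ((k : ℝ) + 1))) 0 := le_max_right _ _
        have h3 := le_max_left (w ⬝ᵥ w - (v ω ⬝ᵥ v ω - 1 / ((k : ℝ) + 1))) 0
        have h0 : max (w ⬝ᵥ w - (v ω ⬝ᵥ v ω - 1 / ((k : ℝ) + 1))) 0 +
          ∑ i ∈ T, max (f ω i w - γ ω) 0 ≤ 0 := h
        refine ⟨w, hw.1, γ ω, (hsum _ _ _).1 (by linarith), Or.inr ⟨rfl, ?_⟩⟩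
        have : (0 : ℝ) < 1 / ((k : ℝ) + 1) := by positivity
        linarith
  rw [← MeasurableSet.compl_iff, heq]
  exact (MeasurableSet.iUnion fun k => MeasurableSet.iUnion fun R => h₁ k R).union
    (MeasurableSet.iUnion fun k => MeasurableSet.iUnion fun R => h₂ k R)

end Measurability

/-! ### The scenario bound in one convex piece. -/

/-- The scenario bound for a convex min-max program with lexicographic tie-break. -/
theorem scenario_bound {ι : Type*} [Fintype ι] {Ω : Type*} [MeasurableSpace Ω] (P : Measure Ω)
    [IsProbabilityMeasure P] {n : ℕ} {K : Set (ι → ℝ)} (hKc : IsClosed K) (hK : Convex ℝ K)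
    {q : Ω → (ι → ℝ) → ℝ} (hqm : ∀ w, Measurable fun ω => q ω w) (hqc : ∀ ω, Continuous (q ω))
    (hq : ∀ ω, ConvexOn ℝ univ (q ω)) {v : (Fin n → Ω) → ι → ℝ} {γ : (Fin n → Ω) → ℝ}
    (hv : Measurable v) (hγ : Measurable γ) {B : Set (Fin n → Ω)} (hB : MeasurableSet B)
    {ε L : ℝ} (hε₀ : 0 < ε) (hε₁ : ε < 1) (hL : 0 ≤ L)
    (hn : 2 / ε * (L + ((Fintype.card ι : ℝ) + 1)) ≤ n)
    (hBK : ∀ ω ∈ B, v ω ∈ K) (hBq : ∀ ω ∈ B, ∀ i, q (ω i) (v ω) ≤ γ ω)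
    (hBopt : ∀ ω ∈ B, IsLexOptimal K (fun i => q (ω i)) Finset.univ (v ω) (γ ω))
    (hBε : ∀ ω ∈ B, ε < P.real {ω' | γ ω < q ω' (v ω)}) :
    (Measure.pi fun _ : Fin n => P).real B < Real.exp (-L) := by
  set d := Fintype.card ι + 1
  have hdn : 2 * (d : ℝ) ≤ n := by
    have h1 : 2 * (d : ℝ) ≤ 2 / ε * (L + ((Fintype.card ι : ℝ) + 1)) := by
      rw [div_mul_eq_mul_div, le_div_iff₀ hε₀]
      have : (0 : ℝ) ≤ Fintype.card ι := by positivity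
      simp only [d]
      push_cast
      nlinarith
    exact h1.trans hn
  have hdn' : 2 * d ≤ n := by exact_mod_cast hdn
  have hcount := measure_mul_choose_le P (d := d) (t := n / 2) (by omega) (by omega) hB
    (A := fun T => B ∩ {ω | IsLexOptimal K (fun i => q (ω i)) T (v ω) (γ ω)})
    (fun T => hB.inter (measurableSet_isLexOptimal hKc
      (fun i w => (hqm w).comp (measurable_pi_apply i)) (fun ω i => hqc (ω i)) T hv hγ))
    (fun ω hω => by
      obtain ⟨I, hI, h⟩ := (hBopt ω hω).exists_basis hK (fun i => hq (ω i)) (hBK ω hω)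
        (hBq ω hω) (by rw [Fintype.card_fin]; omega)
      exact ⟨I, hI, fun T hT => ⟨hω, h T hT⟩⟩)
    (p := ENNReal.ofReal (1 - ε)) (fun T y => by
      -- All outcomes of `A T` that agree with `y` on `T` share one optimum, so a single
      -- representative `ω₀` provides the set `G` of samples respecting its threshold.
      by_cases hy : ∃ ω ∈ B ∩ {ω | IsLexOptimal K (fun i => q (ω i)) T (v ω) (γ ω)},
          ∀ i : {i // i ∈ T}, ω i = y i
      · obtain ⟨ω₀, ⟨hω₀, hopt₀⟩, hy₀⟩ := hy
        refine ⟨{ω' | q ω' (v ω₀) ≤ γ ω₀}, ?_, fun ω hω hωy i _ => ?_⟩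
        · have hm : MeasurableSet {ω' | γ ω₀ < q ω' (v ω₀)} :=
            measurableSet_lt measurable_const (hqm _)
          have hc : {ω' | q ω' (v ω₀) ≤ γ ω₀} = {ω' | γ ω₀ < q ω' (v ω₀)}ᶜ := by
            ext; simp
          rw [hc, ← ofReal_measureReal, probReal_compl_eq_one_sub hm]
          exact ENNReal.ofReal_le_ofReal (by linarith [hBε ω₀ hω₀])
        · have hfun : ∀ i ∈ T, ω i = ω₀ i := fun i hi =>
            (hωy ⟨i, hi⟩).trans (hy₀ ⟨i, hi⟩).symm
          have hopt : IsLexOptimal K (fun i => q (ω₀ i)) T (v ω) (γ ω) := by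
            intro w hw g hg
            exact hω.2 w hw g fun i hi => by simpa only [hfun i hi] using hg i hi
          obtain ⟨h1, h2⟩ := hopt₀.unique hK (fun i => hq (ω₀ i)) hopt (hBK _ hω₀)
            (hBK _ hω.1) (fun i _ => hBq _ hω₀ i)
            (fun i hi => by rw [← hfun i hi]; exact hBq _ hω.1 i)
          simp only [mem_ofPred_eq, h1, h2]
          exact hBq _ hω.1 i
      · exact ⟨∅, by simp, fun ω hω hωy => absurd ⟨ω, hω, hωy⟩ hy⟩)
  have hnum := choose_mul_pow_lt (n := n) (d := d) (s := n - n / 2) (t := n / 2) hε₀ hε₁ hL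
    (by omega) (by omega) (by omega) (by omega) (by simpa [d] using hn)
  have hreal : (Measure.pi fun _ : Fin n => P).real B * ((n - d).choose (n - n / 2) : ℝ) ≤
      (n.choose (n - n / 2) : ℝ) * (1 - ε) ^ (n - n / 2) := by
    have := ENNReal.toReal_mono (by finiteness) hcount
    simpa [ENNReal.toReal_mul, Measure.real, ENNReal.toReal_ofReal (by linarith : 0 ≤ 1 - ε)]
      using this
  exact lt_of_mul_lt_mul_right (hreal.trans_lt hnum) (by positivity)

/-! ### Reduction of the two-stage program to its first stage. -/

section Program

variable {nr nx nz nf dH dL dF dN n : ℕ}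
  {Q : Matrix (Fin (dN + 1) × Fin nr) (Fin (dN + 1) × Fin nr) ℝ}

theorem quadForm_smul (Q : Matrix (Fin (dN + 1) × Fin nr) (Fin (dN + 1) × Fin nr) ℝ) (c : ℝ)
    (N : Coeffs dN nr) : quadForm Q (c • N) = c ^ 2 * quadForm Q N := by
  simp only [quadForm, Matrix.mulVec_smul, dotProduct_smul, smul_dotProduct, smul_eq_mul]
  ring

theorem continuous_quadForm
    (Q : Matrix (Fin (dN + 1) × Fin nr) (Fin (dN + 1) × Fin nr) ℝ) : Continuous (quadForm Q) :=
  continuous_id.dotProduct (continuous_const.matrix_mulVec continuous_id)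

theorem convexOn_quadForm (hQ : ∀ N, 0 ≤ quadForm Q N) : ConvexOn ℝ univ (quadForm Q) := by
  refine ⟨convex_univ, fun v _ w _ a b ha hb hab => ?_⟩
  have h : quadForm Q (a • v + b • w) =
      a * quadForm Q v + b * quadForm Q w - a * b * quadForm Q (v - w) := by
    obtain rfl : b = 1 - a := by linarith
    simp only [quadForm, Matrix.mulVec_add, Matrix.mulVec_sub, Matrix.mulVec_smul,
      dotProduct_add, add_dotProduct, dotProduct_sub, sub_dotProduct, dotProduct_smul,
      smul_dotProduct, smul_eq_mul]
    ring
  rw [h]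
  have := mul_nonneg (mul_nonneg ha hb) (hQ (v - w))
  simp only [smul_eq_mul]
  linarith

variable {S : DAE nr nx nz nf dH dL dF}
  {Qs : Fin n → Matrix (Fin (dN + 1) × Fin nr) (Fin (dN + 1) × Fin nr) ℝ}

theorem IsStageOneSolution.of_feasible {N N' : Coeffs dN nr} {γ : ℝ}
    (h : IsStageOneSolution S Qs N γ) (h' : StageOneFeasible S Qs N' γ) :
    IsStageOneSolution S Qs N' γ := ⟨h', h.2⟩

/-- A sign change moves an optimum with a coordinate of N F̄ at most -1 into a piece, so one piece
per coordinate suffices. -/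
theorem IsStageOneSolution.smul_of_sq_eq_one {N : Coeffs dN nr} {γ : ℝ}
    (h : IsStageOneSolution S Qs N γ) {σ : ℝ} (hσ : σ ^ 2 = 1) :
    IsStageOneSolution S Qs (σ • N) γ := by
  refine h.of_feasible ⟨?_, ?_, fun i => ?_⟩
  · rw [Matrix.smul_vecMul, h.1.1, smul_zero]
  · rw [Matrix.smul_vecMul, norm_smul, Real.norm_eq_abs]
    have : |σ| = 1 := by rw [← Real.sqrt_sq_eq_abs, hσ, Real.sqrt_one]
    rw [this, one_mul]
    exact h.1.2.1
  · rw [quadForm_smul, hσ, one_mul]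
    exact h.1.2.2 i

theorem exists_abs_eq_norm {ι : Type*} [Fintype ι] {y : ι → ℝ} (hy : 0 < ‖y‖) :
    ∃ j, |y j| = ‖y‖ := by
  have : Nonempty ι := by
    by_contra h
    rw [not_nonempty_iff] at h
    simp [Subsingleton.elim y 0] at hy
  obtain ⟨j, hj⟩ := Finite.exists_max fun j => |y j|
  refine ⟨j, le_antisymm (norm_le_pi_norm y j) ?_⟩
  exact (pi_norm_le_iff_of_nonneg (abs_nonneg _)).2 hj

/-- Under uniqueness in pieces, an optimal filter of the first stage meets the constraint
`‖N F̄‖ ≥ 1` with equality. -/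
theorem IsStageOneSolution.norm_eq_one (hQ : ∀ i N, 0 ≤ quadForm (Qs i) N)
    (hu : UniqueInPieces S Qs) {N : Coeffs dN nr} {γ : ℝ} (h : IsStageOneSolution S Qs N γ) :
    ‖Matrix.vecMul N (blockToeplitz dN S.F)‖ = 1 := by
  set μ := ‖Matrix.vecMul N (blockToeplitz dN S.F)‖ with hμ
  have hμ1 : 1 ≤ μ := h.1.2.1
  have hμ0 : 0 < μ := by linarith
  obtain ⟨j, hj⟩ := exists_abs_eq_norm (hμ ▸ hμ0)
  obtain ⟨σ, hσ, hσj⟩ : ∃ σ : ℝ, σ ^ 2 = 1 ∧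
      σ * Matrix.vecMul N (blockToeplitz dN S.F) j = μ := by
    rcases abs_choice (Matrix.vecMul N (blockToeplitz dN S.F) j) with h1 | h1
    · exact ⟨1, by norm_num, by rw [one_mul, ← h1, hj]⟩
    · exact ⟨-1, by norm_num, by rw [neg_one_mul, ← h1, hj]⟩
  have h1 := h.smul_of_sq_eq_one hσ
  have h1j : Matrix.vecMul (σ • N) (blockToeplitz dN S.F) j = μ := by
    rw [Matrix.smul_vecMul, Pi.smul_apply, smul_eq_mul, hσj]
  have h2j : Matrix.vecMul (μ⁻¹ • σ • N) (blockToeplitz dN S.F) j = 1 := by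
    rw [Matrix.smul_vecMul, Pi.smul_apply, h1j, smul_eq_mul, inv_mul_cancel₀ hμ0.ne']
  -- Shrinking until coordinate `j` equals 1 stays in piece `j` and does not raise the nonnegative
  -- quadratic forms; uniqueness then forces μ = 1.
  have h2 : IsStageOneSolution S Qs (μ⁻¹ • σ • N) γ := by
    refine h1.of_feasible ⟨?_, ?_, fun i => ?_⟩
    · rw [Matrix.smul_vecMul, h1.1.1, smul_zero]
    · rw [← h2j]
      exact (le_abs_self _).trans
        (norm_le_pi_norm (Matrix.vecMul (μ⁻¹ • σ • N) (blockToeplitz dN S.F)) j)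
    · rw [quadForm_smul]
      refine le_trans ?_ (h1.1.2.2 i)
      refine mul_le_of_le_one_left (hQ i _) (pow_le_one₀ (by positivity) ?_)
      exact inv_le_one_of_one_le₀ hμ1
  have h3 := hu j _ _ γ h1 h2 (by rw [h1j]; exact hμ1) h2j.ge
  rw [← h1j, h3, h2j]

/-- Under uniqueness in pieces, a solution of the two-stage program is, up to normalization, a
solution of the first stage. -/
theorem IsTwoStageSolution.normalize (hQ : ∀ i N, 0 ≤ quadForm (Qs i) N)
    (hu : UniqueInPieces S Qs) {N : Coeffs dN nr} {γ : ℝ} (h : IsTwoStageSolution S Qs N γ) :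
    0 < ‖Matrix.vecMul N (blockToeplitz dN S.F)‖ ∧
    IsStageOneSolution S Qs (‖Matrix.vecMul N (blockToeplitz dN S.F)‖⁻¹ • N)
      (γ / ‖Matrix.vecMul N (blockToeplitz dN S.F)‖ ^ 2) := by
  obtain ⟨N₁, γ₁, N₂, c, h1, h2, hc, rfl, rfl⟩ := h
  have hN₁ : 0 < ‖N₁‖ := by
    rw [norm_pos_iff]
    rintro rfl
    have := h1.1.2.1
    rw [Matrix.zero_vecMul, norm_zero] at this
    linarith
  -- The normalized first-stage filter competes in the second stage. Hence ‖N₁‖ N₂ has at least the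
  -- fault gain of N₁, and it respects the threshold γ₁, so it solves the first stage too.
  have hfeas : StageTwoFeasible S Qs N₁ γ₁ (‖N₁‖⁻¹ • N₁) := by
    refine ⟨by rw [Matrix.smul_vecMul, h1.1.1, smul_zero], ?_, fun i => ?_⟩
    · rw [norm_smul, norm_inv, norm_norm, inv_mul_cancel₀ hN₁.ne']
    · rw [quadForm_smul, ← mul_assoc, ← mul_pow, mul_inv_cancel₀ hN₁.ne', one_pow, one_mul]
      exact h1.1.2.2 i
  have hle := h2.2 _ hfeas
  rw [Matrix.smul_vecMul, norm_smul, norm_inv, norm_norm, inv_mul_le_iff₀ hN₁] at hle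
  have hM : IsStageOneSolution S Qs (‖N₁‖ • N₂) γ₁ := by
    refine h1.of_feasible ⟨by rw [Matrix.smul_vecMul, h2.1.1, smul_zero], ?_, fun i => ?_⟩
    · rw [Matrix.smul_vecMul, norm_smul, norm_norm]
      exact h1.1.2.1.trans hle
    · rw [quadForm_smul]
      exact h2.1.2.2 i
  -- Gain exactly 1 makes the scale c / ‖N₁‖ readable from N alone. Thus dividing by ‖N F̄‖ is a
  -- measurable normalization that needs no measurable choice of N₁, γ₁ or c.
  have hone := hM.norm_eq_one hQ hu
  rw [Matrix.smul_vecMul, norm_smul, norm_norm] at hone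
  have hN₂ : ‖Matrix.vecMul N₂ (blockToeplitz dN S.F)‖ = ‖N₁‖⁻¹ := eq_inv_of_mul_eq_one_right hone
  have hα : ‖Matrix.vecMul (c • N₂) (blockToeplitz dN S.F)‖ = c * ‖N₁‖⁻¹ := by
    rw [Matrix.smul_vecMul, norm_smul, hN₂, Real.norm_of_nonneg hc.le]
  rw [hα]
  refine ⟨by positivity, ?_⟩
  have e1 : (c * ‖N₁‖⁻¹)⁻¹ • c • N₂ = ‖N₁‖ • N₂ := by
    rw [smul_smul]; congr 1; field_simp
  have e2 : c ^ 2 * (γ₁ / ‖N₁‖ ^ 2) / (c * ‖N₁‖⁻¹) ^ 2 = γ₁ := by field_simp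
  rw [e1, e2]
  exact hM

end Program

/-! ### Measurability of the event and the union bound over the pieces. -/

section Final

variable {nr nx nz nf dH dL dF dN n : ℕ} {T : ℝ}

theorem quadForm_signatureMatrix_nonneg (S : DAE nr nx nz nf dH dL dF) (a : Polynomial ℝ)
    (hT : 0 ≤ T) (x : PWC T nx) (N : Coeffs dN nr) :
    0 ≤ quadForm (signatureMatrix S a dN x) N := by
  rw [← l2Norm_residual_sq S a hT]
  exact sq_nonneg _

theorem measurable_quadForm_signatureMatrix (S : DAE nr nx nz nf dH dL dF) (a : Polynomial ℝ)
    (hT : 0 ≤ T) {α : Type*} [MeasurableSpace α] {x : α → PWC T nx} (hx : Measurable x)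
    {N : α → Coeffs dN nr} (hN : Measurable N) :
    Measurable fun ω => quadForm (signatureMatrix S a dN (x ω)) (N ω) := by
  have hNi : ∀ i, Measurable fun ω => N ω i := fun i => (measurable_pi_apply i).comp hN
  simp only [quadForm, dotProduct, Matrix.mulVec]
  refine Finset.measurable_fun_sum _ fun i _ => (hNi i).mul ?_
  refine Finset.measurable_fun_sum _ fun j _ => Measurable.mul ?_ (hNi j)
  exact (continuous_signatureMatrix S a dN hT i j).measurable.comp hx

theorem measurableSet_falseAlarmEvent (S : DAE nr nx nz nf dH dL dF) (a : Polynomial ℝ)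
    (hT : 0 ≤ T) {Ω : Type*} [MeasurableSpace Ω] (P : Measure Ω) [IsProbabilityMeasure P]
    {x : Ω → PWC T nx} (hx : Measurable x) (ε : ℝ)
    {N : (Fin n → Ω) → Coeffs dN nr} {γ : (Fin n → Ω) → ℝ}
    (hN : Measurable N) (hγ : Measurable γ) :
    MeasurableSet (falseAlarmEvent P S a x N γ ε) := by
  have hset : MeasurableSet {z : (Fin n → Ω) × Ω |
      γ z.1 < l2Norm T (residual S a (N z.1) (x z.2)) ^ 2} := by
    simp only [l2Norm_residual_sq S a hT]
    exact measurableSet_lt (hγ.comp measurable_fst)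
      (measurable_quadForm_signatureMatrix S a hT (hx.comp measurable_snd)
        (hN.comp measurable_fst))
  exact measurableSet_lt measurable_const (measurable_measure_prodMk_left hset).ennreal_toReal

/-- The convex piece `N H̄ = 0`, `(N F̄)ⱼ ≥ 1` of the feasible filters of the first stage. -/
def stageOnePiece (S : DAE nr nx nz nf dH dL dF) (dN : ℕ) (j : Fin (dN + dF + 1) × Fin nf) :
    Set (Coeffs dN nr) :=
  {w | Matrix.vecMul w (blockToeplitz dN S.H) = 0 ∧ 1 ≤ Matrix.vecMul w (blockToeplitz dN S.F) j}

theorem continuous_vecMul_apply {ι κ : Type*} [Fintype ι] (M : Matrix ι κ ℝ) (j : κ) :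
    Continuous fun w : ι → ℝ => Matrix.vecMul w M j :=
  (continuous_apply j).comp (continuous_id.matrix_vecMul continuous_const)

theorem isClosed_stageOnePiece (S : DAE nr nx nz nf dH dL dF) (j : Fin (dN + dF + 1) × Fin nf) :
    IsClosed (stageOnePiece S dN j) :=
  (isClosed_eq (continuous_id.matrix_vecMul continuous_const) continuous_const).inter
    (isClosed_le continuous_const (continuous_vecMul_apply _ j))

theorem convex_stageOnePiece (S : DAE nr nx nz nf dH dL dF) (j : Fin (dN + dF + 1) × Fin nf) :
    Convex ℝ (stageOnePiece S dN j) := by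
  rintro v ⟨hv, hv'⟩ w ⟨hw, hw'⟩ a b ha hb hab
  refine ⟨?_, ?_⟩
  · rw [Matrix.add_vecMul, Matrix.smul_vecMul, Matrix.smul_vecMul, hv, hw]; simp
  · rw [Matrix.add_vecMul, Matrix.smul_vecMul, Matrix.smul_vecMul]
    simp only [Pi.add_apply, Pi.smul_apply, smul_eq_mul]
    nlinarith

/-- By uniqueness in the piece, the only competitor of equal value is N itself; for the full sample
the tie-break is never invoked. -/
theorem IsStageOneSolution.isLexOptimal {S : DAE nr nx nz nf dH dL dF}
    {Qs : Fin n → Matrix (Fin (dN + 1) × Fin nr) (Fin (dN + 1) × Fin nr) ℝ}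
    (hu : UniqueInPieces S Qs) {N : Coeffs dN nr} {γ : ℝ} (h : IsStageOneSolution S Qs N γ)
    {j : Fin (dN + dF + 1) × Fin nf} (hj : N ∈ stageOnePiece S dN j) :
    IsLexOptimal (stageOnePiece S dN j) (fun i => quadForm (Qs i)) Finset.univ N γ := by
  intro w hw g hg hlt
  have hfeas : StageOneFeasible S Qs w g :=
    ⟨hw.1, hw.2.trans ((le_abs_self _).trans
      (norm_le_pi_norm (Matrix.vecMul w (blockToeplitz dN S.F)) j)),
      fun i => hg i (Finset.mem_univ i)⟩
  rcases hlt with h1 | ⟨rfl, h1⟩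
  · exact (h.2 w g hfeas).not_gt h1
  · rw [hu j N w g h (h.of_feasible hfeas) hj.2 hw.2] at h1
    exact lt_irrefl _ h1

theorem measure_falseAlarmEvent_lt (S : DAE nr nx nz nf dH dL dF) (a : Polynomial ℝ)
    (hT : 0 ≤ T) {Ω : Type*} [MeasurableSpace Ω] (P : Measure Ω) [IsProbabilityMeasure P]
    {x : Ω → PWC T nx} (hx : Measurable x) {ε : ℝ} (hε₀ : 0 < ε) (hε₁ : ε < 1)
    {N : (Fin n → Ω) → Coeffs dN nr} {γ : (Fin n → Ω) → ℝ}
    (hN : Measurable N) (hγ : Measurable γ)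
    (hsol : ∀ᵐ ω ∂Measure.pi (fun _ : Fin n => P),
      IsTwoStageSolution S (fun i => signatureMatrix S a dN (x (ω i))) (N ω) (γ ω))
    (huniq : ∀ᵐ ω ∂Measure.pi (fun _ : Fin n => P),
      UniqueInPieces S (fun i => signatureMatrix S a dN (x (ω i))))
    {β : ℝ} (hβ₀ : 0 < β) (hβ₁ : β < 1)
    (hn : 2 / ε * (Real.log ((nf : ℝ) * ((dF : ℝ) + (dN : ℝ) + 1) / β)
      + (nr : ℝ) * ((dN : ℝ) + 1) + 1) ≤ (n : ℝ)) :
    (Measure.pi (fun _ : Fin n => P)).real (falseAlarmEvent P S a x N γ ε) < β := by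
  classical
  set π := Measure.pi (fun _ : Fin n => P)
  set E := falseAlarmEvent P S a x N γ ε
  have hE : MeasurableSet E := measurableSet_falseAlarmEvent S a hT P hx ε hN hγ
  obtain ⟨G, (hGae : G ∈ ae π), hGm, hG⟩ := (hsol.and huniq).exists_measurable_mem
  let J := Fin (dN + dF + 1) × Fin nf
  let α : (Fin n → Ω) → ℝ := fun ω => ‖Matrix.vecMul (N ω) (blockToeplitz dN S.F)‖
  let M : (Fin n → Ω) → Coeffs dN nr := fun ω => (α ω)⁻¹ • N ω
  let y : J → (Fin n → Ω) → ℝ := fun j ω => Matrix.vecMul (M ω) (blockToeplitz dN S.F) j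
  -- Where `y j` is ±1, this is the normalized filter with the sign that makes coordinate `j` of its
  -- image equal to (y j)² = 1.
  let v : J → (Fin n → Ω) → Coeffs dN nr := fun j ω => y j ω • M ω
  let g : (Fin n → Ω) → ℝ := fun ω => γ ω / α ω ^ 2
  have hαm : Measurable α := by
    have hc : Continuous fun w : Coeffs dN nr => Matrix.vecMul w (blockToeplitz dN S.F) :=
      continuous_id.matrix_vecMul continuous_const
    exact hc.norm.measurable.comp hN
  have hMm : Measurable M := hαm.inv.smul hN
  have hym : ∀ j, Measurable (y j) := fun j => (continuous_vecMul_apply _ j).measurable.comp hMm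
  have hvm : ∀ j, Measurable (v j) := fun j => (hym j).smul hMm
  have hgm : Measurable g := hγ.div (hαm.pow_const 2)
  have hnn : ∀ (ω : Fin n → Ω) i N', 0 ≤ quadForm (signatureMatrix S a dN (x (ω i))) N' :=
    fun ω i N' => quadForm_signatureMatrix_nonneg S a hT _ _
  have hgood : ∀ ω ∈ G, 0 < α ω ∧ IsStageOneSolution S
      (fun i => signatureMatrix S a dN (x (ω i))) (M ω) (g ω) := fun ω hω =>
    (hG ω hω).1.normalize (hnn ω) (hG ω hω).2
  have hpiece : ∀ ω ∈ G, ∃ j, y j ω ^ 2 = 1 := by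
    intro ω hω
    have h1 := (hgood ω hω).2.norm_eq_one (hnn ω) (hG ω hω).2
    obtain ⟨j, hj⟩ := exists_abs_eq_norm (h1 ▸ one_pos)
    refine ⟨j, ?_⟩
    rw [← sq_abs, show |y j ω| = 1 from hj.trans h1, one_pow]
  let B : J → Set (Fin n → Ω) := fun j => E ∩ G ∩ {ω | y j ω ^ 2 = 1}
  have hBm : ∀ j, MeasurableSet (B j) := fun j =>
    (hE.inter hGm).inter (((hym j).pow_const 2) (measurableSet_singleton 1))
  have hEB : π.real E ≤ ∑ j, π.real (B j) := by
    refine le_trans ?_ (measureReal_biUnion_finset_le _ _)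
    refine ENNReal.toReal_mono (measure_ne_top _ _) (measure_mono_ae ?_)
    filter_upwards [hGae] with ω hω hωE
    obtain ⟨j, hj⟩ := hpiece ω hω
    exact mem_biUnion (Finset.mem_coe.2 (Finset.mem_univ j)) ⟨⟨hωE, hω⟩, hj⟩
  -- A first-stage solution has a nonzero N F̄, so there is at least one coordinate; this makes the
  -- logarithm below nonnegative.
  have hJ : Nonempty J := by
    obtain ⟨ω, hω⟩ := Filter.nonempty_of_mem hGae
    exact ⟨(hpiece ω hω).choose⟩
  have hJcard : (Fintype.card J : ℝ) = (nf : ℝ) * ((dF : ℝ) + (dN : ℝ) + 1) := by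
    simp only [J, Fintype.card_prod, Fintype.card_fin]
    push_cast
    ring
  have hJ1 : (1 : ℝ) ≤ Fintype.card J := by exact_mod_cast Fintype.card_pos
  have hq : 0 < (Fintype.card J : ℝ) / β := by positivity
  have hL : 0 ≤ Real.log (Fintype.card J / β) :=
    Real.log_nonneg ((one_le_div hβ₀).2 (by linarith))
  have hBlt : ∀ j, π.real (B j) < β / Fintype.card J := by
    intro j
    have hexp : Real.exp (-Real.log (Fintype.card J / β)) = β / Fintype.card J := by
      rw [Real.exp_neg, Real.exp_log hq, inv_div]
    have hsq : ∀ ω ∈ B j, y j ω ^ 2 = 1 := fun ω hω => hω.2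
    have hvsol : ∀ ω ∈ B j, IsStageOneSolution S
        (fun i => signatureMatrix S a dN (x (ω i))) (v j ω) (g ω) := fun ω hω =>
      (hgood ω hω.1.2).2.smul_of_sq_eq_one hω.2
    have hvK : ∀ ω ∈ B j, v j ω ∈ stageOnePiece S dN j := by
      refine fun ω hω => ⟨(hvsol ω hω).1.1, ?_⟩
      change 1 ≤ Matrix.vecMul (y j ω • M ω) _ j
      rw [Matrix.smul_vecMul, Pi.smul_apply, smul_eq_mul]
      have := hsq ω hω
      rw [sq] at this
      exact this.ge
    rw [← hexp]
    refine scenario_bound P (isClosed_stageOnePiece S j) (convex_stageOnePiece S j)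
      (q := fun ω' => quadForm (signatureMatrix S a dN (x ω')))
      (fun w => measurable_quadForm_signatureMatrix S a hT hx measurable_const)
      (fun ω' => continuous_quadForm _)
      (fun ω' => convexOn_quadForm fun N' => quadForm_signatureMatrix_nonneg S a hT _ _)
      (hvm j) hgm (hBm j) hε₀ hε₁ hL ?_ hvK (fun ω hω => (hvsol ω hω).1.2.2)
      (fun ω hω => (hvsol ω hω).isLexOptimal (hG ω hω.1.2).2 (hvK ω hω)) fun ω hω => ?_
    · refine le_of_eq_of_le ?_ hn
      rw [hJcard, Fintype.card_prod, Fintype.card_fin, Fintype.card_fin]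
      push_cast
      ring
    · have h1 : ε < P.real {ω' | γ ω < l2Norm T (residual S a (N ω) (x ω')) ^ 2} := hω.1.1
      -- Passing from (N, γ) to (v, g) leaves the false-alarm set unchanged: the sign disappears in
      -- the square, and both sides carry the factor 1 / α².
      convert h1 using 3
      ext ω'
      have hα := (hgood ω hω.1.2).1
      simp only [l2Norm_residual_sq S a hT, v, M, g, quadForm_smul, hsq ω hω]
      rw [one_mul, inv_pow, ← div_eq_inv_mul, div_lt_div_iff_of_pos_right (by positivity)]
  calc π.real E ≤ ∑ j, π.real (B j) := hEB
    _ < ∑ _j : J, β / Fintype.card J :=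
        Finset.sum_lt_sum_of_nonempty Finset.univ_nonempty fun j _ => hBlt j
    _ = β := by
        rw [Finset.sum_const, Finset.card_univ, nsmul_eq_mul]
        field_simp

end Final

end FDI

theorem theorem4p9 {nr nx nz nf dH dL dF dN : ℕ} (S : FDI.DAE nr nx nz nf dH dL dF)
    (a : Polynomial ℝ) (ha : FDI.IsStable a) (hdeg : dN ≤ a.natDegree)
    {T : ℝ} (hT : 0 < T)
    {Ω : Type*} [MeasurableSpace Ω] (P : MeasureTheory.Measure Ω)
    [MeasureTheory.IsProbabilityMeasure P]
    (x : Ω → FDI.PWC T nx) (hx : Measurable x)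
    {ε : ℝ} (hε₀ : 0 < ε) (hε₁ : ε < 1) (n : ℕ)
    (N : (Fin n → Ω) → FDI.Coeffs dN nr) (γ : (Fin n → Ω) → ℝ)
    (hN : Measurable N) (hγ : Measurable γ)
    (hsol : ∀ᵐ ω ∂MeasureTheory.Measure.pi (fun _ : Fin n => P),
      FDI.IsTwoStageSolution S (fun i => FDI.signatureMatrix S a dN (x (ω i))) (N ω) (γ ω)) :
    MeasurableSet (FDI.falseAlarmEvent P S a x N γ ε) ∧
    ((∀ᵐ ω ∂MeasureTheory.Measure.pi (fun _ : Fin n => P),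
        FDI.UniqueInPieces S (fun i => FDI.signatureMatrix S a dN (x (ω i)))) →
      ∀ β : ℝ, 0 < β → β < 1 →
        2 / ε * (Real.log ((nf : ℝ) * ((dF : ℝ) + (dN : ℝ) + 1) / β)
          + (nr : ℝ) * ((dN : ℝ) + 1) + 1) ≤ (n : ℝ) →
        (MeasureTheory.Measure.pi (fun _ : Fin n => P)).real
          (FDI.falseAlarmEvent P S a x N γ ε) < β) := by
  refine ⟨FDI.measurableSet_falseAlarmEvent S a hT.le P hx ε hN hγ, fun huniq β hβ₀ hβ₁ hn => ?_⟩
  exact FDI.measure_falseAlarmEvent_lt S a hT.le P hx hε₀ hε₁ hN hγ hsol huniq hβ₀ hβ₁ hn
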